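/- **Setting.** Consider an implicit $m$-stage Runge–Kutta method with real coefficient matrix $a=(a_{ij})$ and weights $b=(b_j)$. Put $$q(z)=(q_1(z),\dots,q_m(z))=b^T(I-za)^{-1},\qquad r(z)=1+z\,b^T(I-za)^{-1}(1,\dots,1)^T .$$ Assume that all eigenvalues of $a$ have positive real part, that $\sum_j b_j=1$ (i.e. $r'(0)=1$), and that the method is L-stable: $|r(z)|\le 1$ for $\operatorname{Re}z\le 0$, and $r(\infty)=0$. Let $M,\sigma\in\mathbb R$ and $0\le\varphi<\pi/2$. A bounded linear operator $A$ on a complex Banach space (in particular a matrix, with any vector norm) is called sectorial with constants $M,\varphi,\sigma$ if, for all complex $\lambda\neq\sigma$ with $|\arg(\lambda-\sigma)|\le\pi-\varphi$, the operator $\lambda+A$ is invertible and $\|(\lambda+A)^{-1}\|\le M/|\lambda-\sigma|$. The operators $r(-hA)$ and $q_i(-hA)$ are obtained by substituting $-hA$ for $z$ above. Fix an integer $B>1$, an angle $0<\alpha<\frac\pi2-\varphi$ and a constant $c_1>0$. For $h>0$, $\ell\ge1$ let $I_\ell=[B^{\ell-1}h,B^\ell h)$. For $0<\varepsilon\le\frac12$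 and a constant $s>0$ set $$\mu_\ell=\frac{c_1\log(1/\varepsilon)}{B^\ell h},\qquad \tau=\frac{s}{\log(1/\varepsilon)},\qquad \gamma_\ell(\theta)=\mu_\ell\bigl(1-\sin(\alpha+i\theta)\bigr)+\sigma,$$ $$\lambda_k^{(\ell)}=\gamma_\ell(k\tau),\qquad w_k^{(\ell)}=\frac{i\tau}{2\pi}\gamma_\ell'(k\tau).$$ For a nonnegative integer $K$ define the row vector of operators $$E=r(-hA)^nq(-hA)-\sum_{k=-K}^{K}w_k^{(\ell)}\,(\lambda_k^{(\ell)}+A)^{-1}\,r(h\lambda_k^{(\ell)})^n\,q(h\lambda_k^{(\ell)}),$$ with its size measured by the sum of the operator norms of its $m$ entries. **Theorem.** There are constants $h_0>0$ and $c>0$, depending only on the method, $B$, $M$, $\sigma$, $\varphi$, $\alpha$ and $c_1$, such that the following holds. 1. For every $T>0$ there are $C,s>0$, depending only on these data and $T$, such that for every $0<\varepsilon\le\frac12$ there is $K\le C\log(1/\varepsilon)$ for which $\|E\|\le\varepsilon$ holds for all $A$ sectorial with constants $M,\varphi,\sigma$ (on an arbitrary complex Banach space), all $0<h\le h_0$,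 all $\ell\ge1$ and all integers $n\ge c\log(1/\varepsilon)$ with $nh\in I_\ell$ and $nh\le T$. Thus $K=O(\log\frac1\varepsilon)$ is independent of $\ell$, $n$ and $h$, and depends on $A$ only through $M,\varphi,\sigma$. 2. If $\sigma\le0$, then $C$, $s$ and $K$ can also be chosen independently of $T$; that is, the statement in 1 holds without the restriction $nh\le T$. -/

import Mathlib

noncomputable section

namespace RungeKuttaContour

section RationalFunctions

variable {m : ℕ} {R : Type*} [Ring R] [Algebra ℂ R]

/-- The inverse `(I - z 𝒪)⁻¹` of the block matrix `I - 𝒪 ⊗ z` with entries in a complex algebra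
`R`, for the Runge-Kutta matrix `a = 𝒪` and an element `z` of `R`.  Taking `R = ℂ` gives the
scalar matrix, and taking for `R` the bounded operators on a Banach space gives the operator
version, with an operator substituted for `z`. -/
def stageInverse (a : Matrix (Fin m) (Fin m) ℝ) (z : R) : Matrix (Fin m) (Fin m) R :=
  Ring.inverse (1 - a.map fun x : ℝ => (x : ℂ) • z)

/-- The `i`-th entry of the row vector `q(z) = bᵀ (I - z 𝒪)⁻¹`. -/
def q (a : Matrix (Fin m) (Fin m) ℝ) (b : Fin m → ℝ) (i : Fin m) (z : R) : R :=
  ∑ j, (b j : ℂ) • stageInverse a z j i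

/-- The stability function `r(z) = 1 + z bᵀ (I - z 𝒪)⁻¹ 𝟙`. -/
def r (a : Matrix (Fin m) (Fin m) ℝ) (b : Fin m → ℝ) (z : R) : R :=
  1 + z * ∑ i, q a b i z

end RationalFunctions

/-- The assumptions on the implicit Runge-Kutta method with matrix `a` and weights `b`. -/
structure IsAdmissible {m : ℕ} (a : Matrix (Fin m) (Fin m) ℝ) (b : Fin m → ℝ) : Prop where
  /-- All (complex) eigenvalues of the Runge-Kutta matrix have positive real part. -/
  eigenvalues_re_pos : ∀ z ∈ spectrum ℂ (a.map fun x : ℝ => (x : ℂ)), 0 < z.re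
  /-- Consistency, that is `r'(0) = 1`. -/
  consistent : ∑ i, b i = 1
  /-- L-stability, first half: `|r| ≤ 1` on the closed left half-plane. -/
  norm_r_le_one : ∀ z : ℂ, z.re ≤ 0 → ‖r a b z‖ ≤ 1
  /-- L-stability, second half: `r(∞) = 0`. -/
  r_infty : Filter.Tendsto (fun z : ℂ => r a b z) (Filter.cocompact ℂ) (nhds 0)

/-- `A` is sectorial with constants `M`, `σ`, `φ`: for all `z ≠ σ` with
`|arg (z - σ)| ≤ π - φ`, the operator `z + A` is invertible and `‖(z + A)⁻¹‖ ≤ M / |z - σ|`.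
Here `resolvent (-A) z = (z + A)⁻¹`. -/
def IsSectorial {E : Type*} [NormedAddCommGroup E] [NormedSpace ℂ E]
    (A : E →L[ℂ] E) (M σ φ : ℝ) : Prop :=
  ∀ z : ℂ, z ≠ σ → |(z - σ).arg| ≤ Real.pi - φ →
    z ∈ resolventSet ℂ (-A) ∧ ‖resolvent (-A) z‖ ≤ M / ‖z - σ‖

/-- The hyperbola `γ(θ) = μ (1 - sin(α + iθ)) + σ`. -/
def hyperbola (α μ σ θ : ℝ) : ℂ :=
  μ * (1 - Complex.sin (α + Complex.I * θ)) + σ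

/-- The quadrature weight `w_k = (i τ / 2π) γ'(kτ)`. -/
def weight (α μ σ τ : ℝ) (k : ℤ) : ℂ :=
  Complex.I * τ / (2 * Real.pi) * deriv (hyperbola α μ σ) (k * τ)

/-- The quadrature point `λ_k = γ(kτ)`. -/
def node (α μ σ τ : ℝ) (k : ℤ) : ℂ :=
  hyperbola α μ σ (k * τ)

/-- The `i`-th entry of the contour quadrature approximation
`∑_{k=-K}^{K} w_k (λ_k + A)⁻¹ r(hλ_k)ⁿ q(hλ_k)` of `r(-hA)ⁿ q(-hA)`. -/
def quadrature {m : ℕ} (a : Matrix (Fin m) (Fin m) ℝ) (b : Fin m → ℝ)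
    {E : Type*} [NormedAddCommGroup E] [NormedSpace ℂ E] (A : E →L[ℂ] E)
    (α μ σ τ h : ℝ) (K n : ℕ) (i : Fin m) : E →L[ℂ] E :=
  ∑ k ∈ Finset.Icc (-(K : ℤ)) (K : ℤ),
    (weight α μ σ τ k * r a b ((h : ℂ) * node α μ σ τ k) ^ n
      * q a b i ((h : ℂ) * node α μ σ τ k)) • resolvent (-A) (node α μ σ τ k)

/-- The norm of the quadrature error, a row vector of `m` operators, measured by the sum of the
operator norms of its entries.  (This dominates its operator norm from `E^m` to `E` for every
`ℓ^p` norm on `E^m`.) -/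
def quadratureError {m : ℕ} (a : Matrix (Fin m) (Fin m) ℝ) (b : Fin m → ℝ)
    {E : Type*} [NormedAddCommGroup E] [NormedSpace ℂ E] (A : E →L[ℂ] E)
    (α μ σ τ h : ℝ) (K n : ℕ) : ℝ :=
  ∑ i, ‖r a b (-((h : ℂ) • A)) ^ n * q a b i (-((h : ℂ) • A))
    - quadrature a b A α μ σ τ h K n i‖

/-- The time interval `I_ℓ = [B^(ℓ-1) h, B^ℓ h)`, for `ℓ ≥ 1`. -/
def timeInterval (B : ℕ) (h : ℝ) (l : ℕ) : Set ℝ :=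
  Set.Ico ((B : ℝ) ^ (l - 1) * h) ((B : ℝ) ^ l * h)

end RungeKuttaContour

end

universe u

/-!
Write `ℓ = log (1/ε)`. After scaling by `h` the contour is the hyperbola `arc ν ς` on the vertical
line `Re w = α`, with `ν = h μ`, `ς = h σ`, and the element substituted for `z` is `Z = -hA`; the
exponent satisfies `n ν ∈ [c₁ ℓ / B, c₁ ℓ]` and `n ≥ c ℓ`.

*Exactness.* `r(z)ⁿ q(z)` is a quotient of polynomials, so that `r(z)ⁿ q(z) (z - Z)⁻¹` is the sum of
`r(Z)ⁿ q(Z) (z - Z)⁻¹`, analytic to the right of the hyperbola, and a divided difference, analytic to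
its left (`smul_resolvent_eq_add_regularPart`). The lines `Re w = ± π / 2` are folded onto real
half-lines, where the integrals cancel, so moving the two summands there leaves only the limits at
the ends, and these add up to `2 π r(Z)ⁿ q(Z)` (`tendsto_integral_hyperbola`).

*Discretization.* The infinite trapezoidal rule for a function analytic in a strip of half-width `d`
has error `O(exp (-2 π d / τ))` by Poisson summation and a shift of the Fourier integrals
(`norm_trapezoid_sub_integral_le`). With `τ = s / ℓ` this is `ε ^ (2 π d / s)`, which for small `s`
beats the growth `ε ^ (-P)` of the integrand.

*Size of the integrand.* `γ'` times the resolvent is bounded by sectoriality, `q` is bounded, and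
`r` is controlled by stability (`exists_bounds_on_arc`): it is at most `exp (L ν (1 + Λ))` on the
hyperbola, and at most `1 / (1 + u ν exp |θ|)` for large `|θ|`, where the contour lies in a sector
around the negative real axis. The `n`-th power of the latter is both `O(exp (-|θ|))` and, beyond a
constant value of `|θ|`, as small a power of `ε` as desired once `c` is large, whence the truncation
at `K = O(ℓ)` terms.

The final time and the sign of `σ` enter only through a bound `σ ≤ Λ μ`, with the `Λ` above: on
`nh ≤ T` one has `μ ≥ c₁ log 2 / (B T)`, and for `σ ≤ 0` one can take `Λ = 0`. The constants `h₀` and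
`c` do not depend on `Λ` (`exists_quadratureError_le`).
-/

namespace RungeKuttaContour

open Filter Topology MeasureTheory Set

/-! ### The trapezoidal rule on a strip -/

theorem integral_exp_neg_mul_abs {c : ℝ} (hc : 0 < c) :
    ∫ x : ℝ, Real.exp (-(c * |x|)) = 2 / c := by
  rw [integral_comp_abs (f := fun x => Real.exp (-(c * x)))]
  have := integral_exp_mul_Ioi (a := -c) (by linarith) 0
  simp only [neg_mul] at this
  rw [this]
  simp
  ring

theorem integrable_exp_neg_mul_abs {c : ℝ} (hc : 0 < c) :
    Integrable fun x : ℝ => Real.exp (-(c * |x|)) :=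
  Integrable.of_integral_ne_zero (by rw [integral_exp_neg_mul_abs hc]; positivity)

theorem hasSum_int_geometric_natAbs {x : ℝ} (h0 : 0 ≤ x) (h1 : x < 1) :
    HasSum (fun k : ℤ => x ^ k.natAbs) ((1 + x) / (1 - x)) := by
  have hg := hasSum_geometric_of_lt_one h0 h1
  have h2 : HasSum (fun n : ℕ => x ^ (n + 1)) (x * (1 - x)⁻¹) := by
    simpa [pow_succ'] using hg.mul_left x
  have h := HasSum.of_nat_of_neg_add_one (f := fun k : ℤ => x ^ k.natAbs) (by simpa using hg)
    (m' := x * (1 - x)⁻¹) (by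
      convert h2 using 3
      omega)
  convert h using 1
  have : 1 - x ≠ 0 := by linarith
  field_simp

/-- Shifting the line of integration inside a strip of analyticity. -/
theorem integral_horizontal_shift {V : Type*} [NormedAddCommGroup V] [NormedSpace ℂ V]
    [CompleteSpace V] {g : ℂ → V} {y b c : ℝ} (hc : 0 < c)
    (hg : DifferentiableOn ℂ g {z | z.im ∈ uIcc 0 y})
    (hb : ∀ z : ℂ, z.im ∈ uIcc 0 y → ‖g z‖ ≤ b * Real.exp (-(c * |z.re|))) :
    ∫ x : ℝ, g x = ∫ x : ℝ, g (x + y * Complex.I) := by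
  have hline : ∀ t ∈ uIcc 0 y, Integrable fun x : ℝ => g (x + t * Complex.I) := by
    intro t ht
    refine ((integrable_exp_neg_mul_abs hc).const_mul b).mono' ?_ ?_
    · refine Continuous.aestronglyMeasurable ?_
      refine hg.continuousOn.comp_continuous (by fun_prop) fun x => ?_
      simpa using ht
    · refine Eventually.of_forall fun x => ?_
      simpa using hb (x + t * Complex.I) (by simpa using ht)
  have h0 : Integrable fun x : ℝ => g x := by simpa using hline 0 left_mem_uIcc
  have h1 := hline y right_mem_uIcc
  have hexp : Tendsto (fun R : ℝ => b * Real.exp (-(c * |R|)) * |y - 0|) atTop (𝓝 0) := by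
    have : Tendsto (fun R : ℝ => Real.exp (-(c * |R|))) atTop (𝓝 0) :=
      Real.tendsto_exp_neg_atTop_nhds_zero.comp
        ((tendsto_const_nhds.pos_mul_atTop hc) tendsto_abs_atTop_atTop)
    simpa using (this.const_mul b).mul_const |y - 0|
  have hside : ∀ a : ℝ → ℝ, (∀ R, |a R| = |R|) →
      Tendsto (fun R : ℝ => ∫ t : ℝ in (0 : ℝ)..y, g (a R + t * Complex.I)) atTop (𝓝 0) := by
    intro a ha
    refine squeeze_zero_norm (fun R => ?_) hexp
    refine intervalIntegral.norm_integral_le_of_norm_le_const fun t ht => ?_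
    have := hb (a R + t * Complex.I) (by simpa using uIoc_subset_uIcc ht)
    simpa [ha] using this
  have hrect : ∀ R : ℝ, (∫ x : ℝ in (-R)..R, g x) - (∫ x : ℝ in (-R)..R, g (x + y * Complex.I))
      + Complex.I • (∫ t : ℝ in (0 : ℝ)..y, g ((R : ℝ) + t * Complex.I))
      - Complex.I • (∫ t : ℝ in (0 : ℝ)..y, g ((-R : ℝ) + t * Complex.I)) = 0 := by
    intro R
    have := Complex.integral_boundary_rect_eq_zero_of_differentiableOn g ((-R : ℝ) : ℂ)
      (R + y * Complex.I) (hg.mono fun z hz => by simpa using hz.2)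
    simpa using this
  have hlim := (((intervalIntegral_tendsto_integral h0 tendsto_neg_atTop_atBot tendsto_id).sub
    (intervalIntegral_tendsto_integral h1 tendsto_neg_atTop_atBot tendsto_id)).add
    ((hside (fun R => R) fun R => rfl).const_smul Complex.I)).sub
    ((hside (fun R => -R) fun R => abs_neg R).const_smul Complex.I)
  have := tendsto_nhds_unique (hlim.congr fun R => hrect R) tendsto_const_nhds
  simpa [sub_eq_zero] using this

/-- The Fourier coefficients of an analytic function on a strip decay exponentially. -/
theorem norm_fourier_le_of_strip {g : ℂ → ℂ} {d b c : ℝ} (hc : 0 < c) (hd : 0 ≤ d)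
    (hg : DifferentiableOn ℂ g {z | |z.im| ≤ d})
    (hb : ∀ z : ℂ, |z.im| ≤ d → ‖g z‖ ≤ b * Real.exp (-(c * |z.re|))) (j : ℤ) :
    ‖FourierTransform.fourier (fun x : ℝ => g x) (j : ℝ)‖
      ≤ 2 * b / c * Real.exp (-(2 * Real.pi * d)) ^ j.natAbs := by
  obtain ⟨y, hyd, hyj⟩ : ∃ y : ℝ, |y| ≤ d ∧ y * j = -(d * j.natAbs) := by
    rcases le_total 0 j with hj | hj
    · refine ⟨-d, by simp [abs_of_nonneg hd], ?_⟩
      rw [← Int.cast_natCast, Int.natAbs_of_nonneg hj]; ring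
    · refine ⟨d, by simp [abs_of_nonneg hd], ?_⟩
      rw [← Int.cast_natCast, Int.ofNat_natAbs_of_nonpos hj]; push_cast; ring
  have hsub : ∀ z : ℂ, z.im ∈ uIcc 0 y → |z.im| ≤ d := fun z hz =>
    (by simpa using abs_sub_left_of_mem_uIcc hz : |z.im| ≤ |y|).trans hyd
  have hbnn : 0 ≤ b := by
    have := (norm_nonneg _).trans (hb 0 (by simpa using hd))
    simpa using this
  set e : ℂ → ℂ := fun z => Complex.exp (-2 * Real.pi * j * Complex.I * z)
  have he : ∀ z, ‖e z‖ = Real.exp (2 * Real.pi * (j * z.im)) := by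
    intro z
    simp only [e, Complex.norm_exp]
    congr 1
    simp
    ring
  have key := integral_horizontal_shift (g := fun z => e z * g z) (y := y) (c := c)
    (b := Real.exp (2 * Real.pi * (|(j : ℝ)| * d)) * b) hc ?_ ?_
  · have hF : FourierTransform.fourier (fun x : ℝ => g x) (j : ℝ)
        = ∫ x : ℝ, e (x + y * Complex.I) * g (x + y * Complex.I) := by
      rw [Real.fourier_real_eq_integral_exp_smul, ← key]
      congr 1 with x
      simp only [e, smul_eq_mul]
      congr 2
      push_cast
      ring
    rw [hF]
    have hle : ∀ x : ℝ, ‖e (x + y * Complex.I) * g (x + y * Complex.I)‖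
        ≤ Real.exp (-(2 * Real.pi * d)) ^ j.natAbs * b * Real.exp (-(c * |x|)) := by
      intro x
      have h1 := hb (x + y * Complex.I) (by simpa using hyd)
      simp only [Complex.add_re, Complex.ofReal_re, Complex.mul_re, Complex.I_re, mul_zero,
        Complex.ofReal_im, Complex.I_im, mul_one, sub_self, add_zero] at h1
      have h2 : Real.exp (2 * Real.pi * (j * ((x : ℂ) + y * Complex.I).im))
          = Real.exp (-(2 * Real.pi * d)) ^ j.natAbs := by
        rw [← Real.exp_nat_mul]
        congr 1
        have : (((x : ℂ) + y * Complex.I).im) = y := by simp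
        rw [this, mul_comm (j : ℝ), hyj]
        ring
      rw [norm_mul, he, h2, mul_assoc (_ ^ _)]
      gcongr
    refine (norm_integral_le_of_norm_le
      ((integrable_exp_neg_mul_abs hc).const_mul _) (Eventually.of_forall hle)).trans ?_
    rw [integral_const_mul, integral_exp_neg_mul_abs hc]
    exact le_of_eq (by ring)
  · refine DifferentiableOn.mul (Differentiable.differentiableOn (by fun_prop))
      (hg.mono fun z hz => hsub z hz)
  · intro z hz
    rw [norm_mul, he, mul_assoc (Real.exp _) b]
    refine mul_le_mul ?_ (hb z (hsub z hz)) (norm_nonneg _) (Real.exp_pos _).le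
    refine Real.exp_le_exp.2 (mul_le_mul_of_nonneg_left ?_ Real.two_pi_pos.le)
    calc (j : ℝ) * z.im ≤ |(j : ℝ) * z.im| := le_abs_self _
      _ = |(j : ℝ)| * |z.im| := abs_mul _ _
      _ ≤ _ := by gcongr; exact hsub z hz

theorem isBigO_exp_neg_mul_abs_rpow {c : ℝ} (hc : 0 < c) :
    (fun x : ℝ => Real.exp (-(c * |x|))) =O[cocompact ℝ] fun x => |x| ^ (-2 : ℝ) := by
  have h := (isLittleO_exp_neg_mul_rpow_atTop hc (-2)).isBigO
  have := h.comp_tendsto (tendsto_norm_cocompact_atTop (E := ℝ))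
  simpa [Function.comp_def] using this

/-- The trapezoidal rule with step `1`, for scalar functions. -/
theorem norm_tsum_sub_integral_le_scalar {g : ℂ → ℂ} {d b c : ℝ} (hc : 0 < c) (hd : 0 < d)
    (hg : DifferentiableOn ℂ g {z | |z.im| ≤ d})
    (hb : ∀ z : ℂ, |z.im| ≤ d → ‖g z‖ ≤ b * Real.exp (-(c * |z.re|))) :
    ‖∑' k : ℤ, g k - ∫ x : ℝ, g x‖ ≤ 4 * b / c / (Real.exp (2 * Real.pi * d) - 1) := by
  set x := Real.exp (-(2 * Real.pi * d)) with hx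
  have hx0 : 0 < x := Real.exp_pos _
  have hx1 : x < 1 := by
    rw [hx, Real.exp_lt_one_iff]
    have := Real.pi_pos
    have : 0 < 2 * Real.pi * d := by positivity
    linarith
  have hF := norm_fourier_le_of_strip hc hd.le hg hb
  have hgeo := hasSum_int_geometric_natAbs hx0.le hx1
  have hsum : Summable fun k : ℤ => FourierTransform.fourier (fun x : ℝ => g x) (k : ℝ) :=
    Summable.of_norm_bounded (hgeo.summable.mul_left (2 * b / c)) hF
  have hcont : Continuous fun x : ℝ => g x :=
    hg.continuousOn.comp_continuous (by fun_prop) fun x => by simpa using hd.le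
  have hO : (fun x : ℝ => g x) =O[cocompact ℝ] fun x : ℝ => |x| ^ (-2 : ℝ) := by
    refine Asymptotics.IsBigO.trans ?_ (isBigO_exp_neg_mul_abs_rpow hc)
    refine Asymptotics.IsBigO.of_bound b (Eventually.of_forall fun x => ?_)
    have := hb x (by simpa using hd.le)
    simpa using this
  have hP := Real.tsum_eq_tsum_fourier_of_rpow_decay_of_summable hcont one_lt_two hO hsum 0
  have h0 : FourierTransform.fourier (fun x : ℝ => g x) ((0 : ℤ) : ℝ) = ∫ x : ℝ, g x := by
    rw [Real.fourier_real_eq_integral_exp_smul]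
    simp
  have hP' : ∑' k : ℤ, g k = ∑' k : ℤ, FourierTransform.fourier (fun x : ℝ => g x) (k : ℝ) := by
    simpa using hP
  rw [hP', hsum.tsum_eq_add_tsum_ite 0, h0, add_sub_cancel_left]
  have hgeo0 : HasSum (fun k : ℤ => if k = 0 then 0 else x ^ k.natAbs)
      ((1 + x) / (1 - x) - 1) := by
    have h := hgeo.update 0 0
    have hupd : Function.update (fun k : ℤ => x ^ k.natAbs) 0 0
        = fun k : ℤ => if k = 0 then 0 else x ^ k.natAbs := by
      ext k
      rw [Function.update_apply]
    rw [hupd, Int.natAbs_zero, pow_zero, zero_sub, neg_add_eq_sub] at h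
    exact h
  refine (tsum_of_norm_bounded (hgeo0.mul_left (2 * b / c)) fun k => ?_).trans (le_of_eq ?_)
  · split_ifs
    · simp
    · exact hF k
  · have hE : Real.exp (2 * Real.pi * d) = x⁻¹ := by rw [hx, Real.exp_neg, inv_inv]
    rw [hE]
    have : 1 - x ≠ 0 := by linarith
    have : x⁻¹ - 1 ≠ 0 := by
      have := one_lt_inv_iff₀.2 ⟨hx0, hx1⟩
      linarith
    have h3 : x⁻¹ - 1 = (1 - x) / x := by field_simp
    rw [h3]
    field_simp
    ring

/-- The error of the infinite trapezoidal rule with step `τ`, for a vector-valued function that is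
analytic and exponentially decaying on the strip `|Im z| ≤ d`. -/
theorem norm_trapezoid_sub_integral_le {V : Type*} [NormedAddCommGroup V] [NormedSpace ℂ V]
    [CompleteSpace V] {g : ℂ → V} {d b τ : ℝ} (hτ : 0 < τ) (hd : 0 < d)
    (hg : DifferentiableOn ℂ g {z | |z.im| ≤ d})
    (hb : ∀ z : ℂ, |z.im| ≤ d → ‖g z‖ ≤ b * Real.exp (-|z.re|)) :
    (Summable fun k : ℤ => (τ : ℂ) • g (k * τ)) ∧
    ‖∑' k : ℤ, (τ : ℂ) • g (k * τ) - ∫ x : ℝ, g x‖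
      ≤ 4 * b / (Real.exp (2 * Real.pi * d / τ) - 1) := by
  have hbnn : 0 ≤ b := by
    have := (norm_nonneg _).trans (hb 0 (by simpa using hd.le))
    simpa using this
  have hint : Integrable fun x : ℝ => g x := by
    refine ((integrable_exp_neg_mul_abs one_pos).const_mul b).mono' ?_ ?_
    · exact Continuous.aestronglyMeasurable (hg.continuousOn.comp_continuous (by fun_prop)
        fun x => by simpa using hd.le)
    · refine Eventually.of_forall fun x => ?_
      simpa using hb x (by simpa using hd.le)
  have hsum : Summable fun k : ℤ => (τ : ℂ) • g (k * τ) := by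
    have hx1 : Real.exp (-τ) < 1 := by simpa using hτ
    refine Summable.of_norm_bounded (((hasSum_int_geometric_natAbs (Real.exp_pos _).le
      hx1).summable).mul_left (τ * b)) fun k => ?_
    rw [norm_smul, Complex.norm_real, Real.norm_of_nonneg hτ.le, mul_assoc]
    gcongr
    refine (hb (k * τ) (by simpa using hd.le)).trans (le_of_eq ?_)
    congr 1
    rw [← Real.exp_nat_mul]
    congr 1
    have : ((k : ℂ) * τ).re = k * τ := by simp
    rw [this, abs_mul, abs_of_pos hτ, Nat.cast_natAbs]
    push_cast
    ring
  refine ⟨hsum, ?_⟩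
  have hpos : 0 < Real.exp (2 * Real.pi * d / τ) - 1 := by
    have := Real.pi_pos
    have := Real.add_one_lt_exp (x := 2 * Real.pi * d / τ) (by positivity)
    have : 0 < 2 * Real.pi * d / τ := by positivity
    linarith
  refine NormedSpace.norm_le_dual_bound ℂ _ (by positivity) fun f => ?_
  have hb' : ∀ z : ℂ, |z.im| ≤ d / τ →
      ‖(τ : ℂ) * f (g (τ * z))‖ ≤ τ * (‖f‖ * b) * Real.exp (-(τ * |z.re|)) := by
    intro z hz
    rw [norm_mul, Complex.norm_real, Real.norm_of_nonneg hτ.le, mul_assoc]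
    gcongr
    refine (f.le_opNorm _).trans ?_
    rw [mul_assoc]
    gcongr
    have := hb (τ * z) (by
      rw [Complex.im_ofReal_mul, abs_mul, abs_of_pos hτ]
      rwa [le_div_iff₀' hτ] at hz)
    rwa [Complex.re_ofReal_mul, abs_mul, abs_of_pos hτ] at this
  have hs := norm_tsum_sub_integral_le_scalar (g := fun z => (τ : ℂ) * f (g (τ * z)))
    (d := d / τ) hτ (by positivity) ?_ hb'
  · rw [map_sub, f.map_tsum hsum, ← f.integral_comp_comm hint]
    have h1 : ∫ x : ℝ, (τ : ℂ) * f (g (τ * x)) = ∫ x : ℝ, f (g x) := by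
      have := Measure.integral_comp_mul_left (fun x : ℝ => f (g x)) τ
      rw [integral_const_mul]
      push_cast at this
      rw [this, abs_of_pos (inv_pos.2 hτ)]
      simp [hτ.ne']
    simp only [h1] at hs
    convert hs using 1
    · congr 2
      refine tsum_congr fun k => ?_
      simp [mul_comm]
    · field_simp
  · refine DifferentiableOn.const_mul ?_ _
    refine f.differentiable.comp_differentiableOn (hg.comp (by fun_prop) fun z hz => ?_)
    simp only [mem_ofPred_eq, Complex.im_ofReal_mul, abs_mul, abs_of_pos hτ] at hz ⊢
    rwa [le_div_iff₀' hτ] at hz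

/-! ### Rational functions of an element of an algebra -/

section Algebra

open Polynomial

variable {m : ℕ} {R : Type*} [Ring R] [Algebra ℂ R]

/-- The matrix `I - X 𝒪` over the polynomial ring `ℂ[X]`. -/
noncomputable def stagePoly (a : Matrix (Fin m) (Fin m) ℝ) : Matrix (Fin m) (Fin m) ℂ[X] :=
  1 - a.map fun x : ℝ => C (x : ℂ) * X

/-- The common denominator `det (I - X 𝒪)` of `r` and the `q i`. -/
noncomputable def denom (a : Matrix (Fin m) (Fin m) ℝ) : ℂ[X] := (stagePoly a).det

/-- The numerator of `q i` over `denom a`. -/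
noncomputable def qNum (a : Matrix (Fin m) (Fin m) ℝ) (b : Fin m → ℝ) (i : Fin m) : ℂ[X] :=
  ∑ j, C (b j : ℂ) * (stagePoly a).adjugate j i

/-- The numerator of `r` over `denom a`. -/
noncomputable def rNum (a : Matrix (Fin m) (Fin m) ℝ) (b : Fin m → ℝ) : ℂ[X] :=
  denom a + X * ∑ i, qNum a b i

theorem stagePoly_map_aeval (a : Matrix (Fin m) (Fin m) ℝ) (Z : R) :
    (stagePoly a).map (aeval Z) = 1 - a.map fun x : ℝ => (x : ℂ) • Z := by
  ext i j
  by_cases h : i = j <;>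
    simp [stagePoly, h, Algebra.smul_def]

theorem commute_aeval (Z : R) (p p' : ℂ[X]) : Commute (aeval Z p) (aeval Z p') := by
  rw [Commute, SemiconjBy, ← map_mul, ← map_mul, mul_comm]

theorem commute_ringInverse_aeval {Z : R} (p : ℂ[X]) {p' : ℂ[X]} (h : IsUnit (aeval Z p')) :
    Commute (aeval Z p) (Ring.inverse (aeval Z p')) := by
  obtain ⟨u, hu⟩ := h
  have := commute_aeval Z p p'
  rw [← hu] at this ⊢
  rw [Ring.inverse_unit]
  exact this.units_inv_right

/-- Cramer's rule for `stageInverse`, in any algebra in which the determinant is invertible. -/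
theorem stageInverse_apply {a : Matrix (Fin m) (Fin m) ℝ} {Z : R}
    (h : IsUnit (aeval Z (denom a))) (i j : Fin m) :
    stageInverse a Z i j
      = aeval Z ((stagePoly a).adjugate i j) * Ring.inverse (aeval Z (denom a)) := by
  set c := Ring.inverse (aeval Z (denom a)) with hc
  set S := (stagePoly a).map (aeval Z) with hS
  set W := (stagePoly a).adjugate.map (aeval Z) with hW
  have hscal : ∀ p : ℂ[X], (p • (1 : Matrix (Fin m) (Fin m) ℂ[X])).map (aeval Z)
      = Matrix.scalar (Fin m) (aeval Z p) := by
    intro p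
    ext i j
    by_cases h : i = j <;> simp [h]
  have h1 : S * W = Matrix.scalar (Fin m) (aeval Z (denom a)) := by
    rw [hS, hW, ← hscal, denom, ← Matrix.mul_adjugate]
    exact (Matrix.map_mul (f := (aeval Z : ℂ[X] →ₐ[ℂ] R).toRingHom)).symm
  have h2 : W * S = Matrix.scalar (Fin m) (aeval Z (denom a)) := by
    rw [hS, hW, ← hscal, denom, ← Matrix.adjugate_mul]
    exact (Matrix.map_mul (f := (aeval Z : ℂ[X] →ₐ[ℂ] R).toRingHom)).symm
  have h3 : S * (W * Matrix.scalar (Fin m) c) = 1 := by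
    rw [← mul_assoc, h1, ← map_mul, Ring.mul_inverse_cancel _ h, map_one]
  have h4 : (Matrix.scalar (Fin m) c * W) * S = 1 := by
    rw [mul_assoc, h2, ← map_mul, Ring.inverse_mul_cancel _ h, map_one]
  have hunit : IsUnit S := isUnit_iff_exists_and_exists.2 ⟨⟨_, h3⟩, ⟨_, h4⟩⟩
  have h5 : stageInverse a Z = W * Matrix.scalar (Fin m) c := by
    rw [stageInverse, ← stagePoly_map_aeval, ← hS]
    calc Ring.inverse S = Ring.inverse S * (S * (W * Matrix.scalar (Fin m) c)) := by
          rw [h3, mul_one]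
      _ = _ := by rw [← mul_assoc, Ring.inverse_mul_cancel _ hunit, one_mul]
  rw [h5]
  simp [hW]

theorem q_eq_aeval {a : Matrix (Fin m) (Fin m) ℝ} {Z : R} (b : Fin m → ℝ)
    (h : IsUnit (aeval Z (denom a))) (i : Fin m) :
    q a b i Z = aeval Z (qNum a b i) * Ring.inverse (aeval Z (denom a)) := by
  simp only [q, qNum, stageInverse_apply h, map_sum, map_mul, aeval_C, Finset.sum_mul,
    Algebra.smul_def, mul_assoc]

theorem r_eq_aeval {a : Matrix (Fin m) (Fin m) ℝ} {Z : R} (b : Fin m → ℝ)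
    (h : IsUnit (aeval Z (denom a))) :
    r a b Z = aeval Z (rNum a b) * Ring.inverse (aeval Z (denom a)) := by
  simp only [r, rNum, q_eq_aeval b h, map_add, map_mul, map_sum, aeval_X, add_mul,
    Ring.mul_inverse_cancel _ h, Finset.sum_mul, mul_assoc]

theorem r_pow_mul_q_eq_aeval {a : Matrix (Fin m) (Fin m) ℝ} {Z : R} (b : Fin m → ℝ)
    (h : IsUnit (aeval Z (denom a))) (n : ℕ) (i : Fin m) :
    r a b Z ^ n * q a b i Z = aeval Z (rNum a b ^ n * qNum a b i)
      * Ring.inverse (aeval Z (denom a ^ (n + 1))) := by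
  have hc := fun p => commute_ringInverse_aeval p h
  have hq : Ring.inverse (aeval Z (denom a)) ^ n * aeval Z (qNum a b i)
      = aeval Z (qNum a b i) * Ring.inverse (aeval Z (denom a)) ^ n :=
    (((hc (qNum a b i)).pow_right n).symm).eq
  have hinv : Ring.inverse (aeval Z (denom a) ^ (n + 1))
      = Ring.inverse (aeval Z (denom a)) ^ (n + 1) := (Ring.inverse_pow _ _).symm
  rw [q_eq_aeval b h, r_eq_aeval b h, (hc _).mul_pow, map_mul, map_pow, map_pow, hinv, pow_succ,
    mul_assoc, ← mul_assoc (_ ^ n) (aeval Z (qNum a b i)), hq]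
  simp only [mul_assoc]

theorem isUnit_aeval_of_eval_ne_zero {p : ℂ[X]} (hp : p ≠ 0) {Z : R}
    (h : ∀ z ∈ spectrum ℂ Z, p.eval z ≠ 0) : IsUnit (aeval Z p) := by
  by_contra hn
  rw [(IsAlgClosed.splits p).eq_prod_roots] at hn
  rw [map_mul, aeval_C] at hn
  have hlead : IsUnit (algebraMap ℂ R p.leadingCoeff) :=
    (isUnit_iff_ne_zero.2 (leadingCoeff_ne_zero.2 hp)).map _
  obtain ⟨k, hk, hk'⟩ := spectrum.exists_mem_of_not_isUnit_aeval_prod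
    (fun h' => hn (hlead.mul h'))
  exact h k hk hk'

/-- The divided difference `(p(z) - p(Z)) / (z - Z)` as a polynomial in `z` and `Z`. -/
noncomputable def divDiff (p : ℂ[X]) (Z : R) (z : ℂ) : R :=
  ∑ k ∈ p.support, p.coeff k • ∑ i ∈ Finset.range k, (algebraMap ℂ R z) ^ i * Z ^ (k - 1 - i)

theorem sub_mul_divDiff (p : ℂ[X]) (Z : R) (z : ℂ) :
    (algebraMap ℂ R z - Z) * divDiff p Z z = algebraMap ℂ R (p.eval z) - aeval Z p := by
  have : ∀ k : ℕ, (algebraMap ℂ R z - Z)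
      * ∑ i ∈ Finset.range k, (algebraMap ℂ R z) ^ i * Z ^ (k - 1 - i)
      = algebraMap ℂ R z ^ k - Z ^ k := fun k =>
    Commute.mul_geom_sum₂ (Algebra.commutes z Z) k
  rw [divDiff, Finset.mul_sum]
  simp only [mul_smul_comm, this]
  rw [aeval_eq_sum_range, eval_eq_sum_range, map_sum, ← Finset.sum_sub_distrib]
  rw [Finset.sum_subset (supp_subset_range_natDegree_succ (p := p))
    (fun k _ hk => by simp [notMem_support_iff.1 hk])]
  refine Finset.sum_congr rfl fun k _ => ?_
  rw [smul_sub, map_mul, map_pow, Algebra.smul_def]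

/-- The regular part of `(N(z)/D(z)) (z - Z)⁻¹`: what remains after subtracting the singular part
`N(Z) D(Z)⁻¹ (z - Z)⁻¹`. -/
noncomputable def regularPart (N D : ℂ[X]) (Z : R) (z : ℂ) : R :=
  (D.eval z)⁻¹ • ((divDiff N Z z * aeval Z D - aeval Z N * divDiff D Z z)
    * Ring.inverse (aeval Z D))

theorem smul_resolvent_eq_add_regularPart {N D : ℂ[X]} {Z : R} {z : ℂ}
    (hD : IsUnit (aeval Z D)) (hz : D.eval z ≠ 0) (hres : z ∈ resolventSet ℂ Z) :
    (N.eval z / D.eval z) • resolvent Z z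
      = aeval Z N * Ring.inverse (aeval Z D) * resolvent Z z + regularPart N D Z z := by
  have hu : IsUnit (algebraMap ℂ R z - Z) := hres
  refine hu.mul_left_cancel ?_
  have hcan : (algebraMap ℂ R z - Z) * resolvent Z z = 1 := Ring.mul_inverse_cancel _ hu
  have hsub : algebraMap ℂ R z - Z = aeval Z (C z - X) := by simp
  have hcomm : (algebraMap ℂ R z - Z) * (aeval Z N * Ring.inverse (aeval Z D))
      = (aeval Z N * Ring.inverse (aeval Z D)) * (algebraMap ℂ R z - Z) := by
    rw [hsub]
    exact ((commute_aeval Z _ _).mul_right (commute_ringInverse_aeval _ hD)).eq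
  have hcommN : (algebraMap ℂ R z - Z) * aeval Z N = aeval Z N * (algebraMap ℂ R z - Z) := by
    rw [hsub]
    exact (commute_aeval Z _ _).eq
  rw [mul_smul_comm, hcan, mul_add, ← mul_assoc, hcomm, mul_assoc (_ * _), hcan, mul_one,
    regularPart, mul_smul_comm, ← mul_assoc, mul_sub, ← mul_assoc, ← mul_assoc, hcommN,
    mul_assoc (aeval Z N), sub_mul_divDiff, sub_mul_divDiff]
  have hexp : (algebraMap ℂ R (N.eval z) - aeval Z N) * aeval Z D
      - aeval Z N * (algebraMap ℂ R (D.eval z) - aeval Z D)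
      = algebraMap ℂ R (N.eval z) * aeval Z D - algebraMap ℂ R (D.eval z) * aeval Z N := by
    rw [Algebra.commutes (D.eval z) (aeval Z N)]
    noncomm_ring
  rw [hexp, sub_mul, mul_assoc, Ring.mul_inverse_cancel _ hD, mul_one, smul_sub, mul_assoc,
    Algebra.smul_def, Algebra.smul_def, Algebra.smul_def, ← mul_assoc (algebraMap ℂ R _)
    (algebraMap ℂ R _) (_ * _), ← map_mul, ← map_mul, inv_mul_cancel₀ hz, map_one, one_mul,
    mul_one]
  rw [div_eq_inv_mul]
  abel

end Algebra

theorem differentiable_divDiff {R : Type*} [NormedRing R] [NormedAlgebra ℂ R]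
    (p : Polynomial ℂ) (Z : R) : Differentiable ℂ (divDiff p Z) := by
  unfold divDiff
  have : Differentiable ℂ (algebraMap ℂ R) := (Algebra.linearMap ℂ R).toContinuousLinearMap.differentiable
  fun_prop

theorem differentiableAt_regularPart {R : Type*} [NormedRing R] [NormedAlgebra ℂ R]
    (N D : Polynomial ℂ) (Z : R) {z : ℂ} (hz : D.eval z ≠ 0) :
    DifferentiableAt ℂ (regularPart N D Z) z := by
  unfold regularPart
  have h1 := differentiable_divDiff N Z z
  have h2 := differentiable_divDiff D Z z
  have h3 : DifferentiableAt ℂ (fun z => (D.eval z)⁻¹) z := D.differentiable.differentiableAt.inv hz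
  exact h3.smul (((h1.mul_const _).sub (h2.const_mul _)).mul_const _)

/-! ### Stability function on half-planes and sectors -/

section StabilityFunction

variable {m : ℕ} {a : Matrix (Fin m) (Fin m) ℝ} {b : Fin m → ℝ}

theorem eval_denom (a : Matrix (Fin m) (Fin m) ℝ) (z : ℂ) :
    (denom a).eval z = (1 - a.map fun x : ℝ => (x : ℂ) • z).det := by
  rw [← stagePoly_map_aeval, denom, ← Polynomial.coe_aeval_eq_eval]
  exact (Polynomial.aeval z : Polynomial ℂ →ₐ[ℂ] ℂ).map_det _

theorem denom_eval_zero (a : Matrix (Fin m) (Fin m) ℝ) : (denom a).eval 0 = 1 := by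
  rw [eval_denom]
  have : (a.map fun x : ℝ => (x : ℂ) • (0 : ℂ)) = 0 := by ext; simp
  rw [this, sub_zero, Matrix.det_one]

theorem denom_ne_zero (a : Matrix (Fin m) (Fin m) ℝ) : denom a ≠ 0 := fun h => by
  simpa [h] using denom_eval_zero a

/-- The zeros of the denominator are the inverses of the eigenvalues of the Runge-Kutta matrix. -/
theorem re_pos_of_denom_eval_eq_zero (hRK : IsAdmissible a b) {z : ℂ}
    (hz : (denom a).eval z = 0) : 0 < z.re := by
  have hz0 : z ≠ 0 := by
    rintro rfl
    simp [denom_eval_zero] at hz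
  have hmem : z⁻¹ ∈ spectrum ℂ (a.map fun x : ℝ => (x : ℂ)) := by
    rw [spectrum.mem_iff, Matrix.isUnit_iff_isUnit_det, isUnit_iff_ne_zero, not_not]
    have : algebraMap ℂ (Matrix (Fin m) (Fin m) ℂ) z⁻¹ - (a.map fun x : ℝ => (x : ℂ))
        = z⁻¹ • (1 - a.map fun x : ℝ => (x : ℂ) • z) := by
      ext i j
      by_cases h : i = j <;> simp [h, Matrix.algebraMap_matrix_apply] <;> field_simp
    rw [this, Matrix.det_smul, ← eval_denom, hz, mul_zero]
  have := hRK.eigenvalues_re_pos _ hmem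
  rw [Complex.inv_re] at this
  exact (div_pos_iff_of_pos_right (Complex.normSq_pos.2 hz0)).1 this

theorem exists_denom_eval_ne_zero (hRK : IsAdmissible a b) :
    ∃ ρ > (0 : ℝ), ∀ z : ℂ, z.re ≤ ρ → (denom a).eval z ≠ 0 := by
  have hfin : ((denom a).roots.toFinset : Set ℂ).Finite := Finset.finite_toSet _
  obtain ⟨ρ, hρ, h⟩ : ∃ ρ > (0 : ℝ), ∀ z ∈ (denom a).roots.toFinset, ρ < z.re := by
    have := (Finset.eventually_all (l := 𝓝[>] (0 : ℝ)) (denom a).roots.toFinset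
      (p := fun z ρ => ρ < z.re)).2 fun z hz => ?_
    · obtain ⟨ρ, h1, h2⟩ := (this.and self_mem_nhdsWithin).exists
      exact ⟨ρ, h2, h1⟩
    · have hz' : (denom a).eval z = 0 := by
        simpa [denom_ne_zero] using hz
      exact (eventually_lt_nhds (re_pos_of_denom_eval_eq_zero hRK hz')).filter_mono
        nhdsWithin_le_nhds
  refine ⟨ρ, hρ, fun z hz h0 => ?_⟩
  have := h z (by simpa [denom_ne_zero] using h0)
  linarith

theorem isUnit_aeval_denom {z : ℂ} (hz : (denom a).eval z ≠ 0) :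
    IsUnit (Polynomial.aeval z (denom a)) := by
  simpa using hz

theorem q_eq_div (b : Fin m → ℝ) {z : ℂ} (hz : (denom a).eval z ≠ 0) (i : Fin m) :
    q a b i z = (qNum a b i).eval z / (denom a).eval z := by
  rw [q_eq_aeval b (isUnit_aeval_denom hz), Ring.inverse_eq_inv', div_eq_mul_inv]
  simp

theorem r_eq_div (b : Fin m → ℝ) {z : ℂ} (hz : (denom a).eval z ≠ 0) :
    r a b z = (rNum a b).eval z / (denom a).eval z := by
  rw [r_eq_aeval b (isUnit_aeval_denom hz), Ring.inverse_eq_inv', div_eq_mul_inv]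
  simp

theorem r_pow_mul_q_eq_div (b : Fin m → ℝ) {z : ℂ} (hz : (denom a).eval z ≠ 0) (n : ℕ)
    (i : Fin m) : r a b z ^ n * q a b i z
      = (rNum a b ^ n * qNum a b i).eval z / (denom a ^ (n + 1)).eval z := by
  rw [r_eq_div b hz, q_eq_div b hz, div_pow, div_mul_div_comm, ← pow_succ]
  simp only [Polynomial.eval_mul, Polynomial.eval_pow]

theorem eventually_denom_eval_ne_zero {z : ℂ} (hz : (denom a).eval z ≠ 0) :
    ∀ᶠ w in 𝓝 z, (denom a).eval w ≠ 0 :=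
  (denom a).continuous.continuousAt.eventually_ne hz

theorem differentiableAt_q (b : Fin m → ℝ) {z : ℂ} (hz : (denom a).eval z ≠ 0) (i : Fin m) :
    DifferentiableAt ℂ (fun z : ℂ => q a b i z) z := by
  have h : DifferentiableAt ℂ (fun z => (qNum a b i).eval z / (denom a).eval z) z :=
    (qNum a b i).differentiable.differentiableAt.div (denom a).differentiable.differentiableAt hz
  refine h.congr_of_eventuallyEq ?_
  filter_upwards [eventually_denom_eval_ne_zero hz] with w hw using q_eq_div b hw i

theorem differentiableAt_r (b : Fin m → ℝ) {z : ℂ} (hz : (denom a).eval z ≠ 0) :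
    DifferentiableAt ℂ (fun z : ℂ => r a b z) z := by
  have h : DifferentiableAt ℂ (fun z => (rNum a b).eval z / (denom a).eval z) z :=
    (rNum a b).differentiable.differentiableAt.div (denom a).differentiable.differentiableAt hz
  refine h.congr_of_eventuallyEq ?_
  filter_upwards [eventually_denom_eval_ne_zero hz] with w hw using r_eq_div b hw

theorem q_zero (a : Matrix (Fin m) (Fin m) ℝ) (b : Fin m → ℝ) (i : Fin m) :
    q a b i (0 : ℂ) = b i := by
  have : (a.map fun x : ℝ => (x : ℂ) • (0 : ℂ)) = 0 := by ext; simp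
  simp only [q, stageInverse, this, sub_zero, Ring.inverse_one, Matrix.one_apply]
  simp

theorem tendsto_q_cocompact (hRK : IsAdmissible a b) (i : Fin m) :
    Tendsto (fun z : ℂ => q a b i z) (cocompact ℂ) (𝓝 0) := by
  let _ : NormedRing (Matrix (Fin m) (Fin m) ℂ) := Matrix.linftyOpNormedRing
  let _ : NormedAlgebra ℂ (Matrix (Fin m) (Fin m) ℂ) := Matrix.linftyOpNormedAlgebra
  set a₀ : Matrix (Fin m) (Fin m) ℂ := a.map fun x : ℝ => (x : ℂ) with ha₀
  have hunit : IsUnit (-a₀) := by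
    rw [IsUnit.neg_iff]
    have : (0 : ℂ) ∉ spectrum ℂ a₀ := fun h => by
      simpa using hRK.eigenvalues_re_pos 0 h
    simpa using spectrum.zero_notMem_iff ℂ |>.1 this
  obtain ⟨u, hu⟩ := hunit
  set v : Matrix (Fin m) (Fin m) ℂ := -((u⁻¹ : (Matrix (Fin m) (Fin m) ℂ)ˣ)) with hv
  -- `(I - z 𝒪)⁻¹ = (z - 𝒪⁻¹)⁻¹ (-𝒪)⁻¹`, and the first factor vanishes at infinity
  have hinv : ∀ z : ℂ, stageInverse a z = resolvent v z * (u⁻¹ : (Matrix (Fin m) (Fin m) ℂ)ˣ) := by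
    intro z
    have h1 : (1 - a.map fun x : ℝ => (x : ℂ) • z)
        = (u : Matrix (Fin m) (Fin m) ℂ) * (algebraMap ℂ _ z - v) := by
      rw [hv, sub_neg_eq_add, mul_add, Units.mul_inv, hu, ha₀]
      ext i j
      simp [Algebra.algebraMap_eq_smul_one, mul_comm]
      ring
    have hc : Commute (u : Matrix (Fin m) (Fin m) ℂ) (algebraMap ℂ _ z - v) := by
      refine Commute.sub_right (Algebra.commutes z _).symm ?_
      rw [hv]
      exact (Commute.neg_right (by simp [Commute, SemiconjBy]))
    rw [stageInverse, h1, Ring.mul_inverse_rev' hc, Ring.inverse_unit, resolvent]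
  have hres : Tendsto (fun z : ℂ => stageInverse a z) (cocompact ℂ) (𝓝 0) := by
    have := (spectrum.resolvent_tendsto_cobounded (𝕜 := ℂ) v).mul_const
      ((u⁻¹ : (Matrix (Fin m) (Fin m) ℂ)ˣ) : Matrix (Fin m) (Fin m) ℂ)
    rw [zero_mul, Metric.cobounded_eq_cocompact] at this
    exact this.congr fun z => (hinv z).symm
  have hentry : ∀ j, Tendsto (fun z : ℂ => stageInverse a z j i) (cocompact ℂ) (𝓝 0) := by
    intro j
    exact ((continuous_id.matrix_elem j i).tendsto (0 : Matrix (Fin m) (Fin m) ℂ)).comp hres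
  have := tendsto_finsetSum Finset.univ fun j _ => (hentry j).const_smul (b j : ℂ)
  simpa [q] using this

/-- A function that is continuous on a closed set and vanishes at infinity is bounded on it. -/
theorem exists_norm_le_of_tendsto_cocompact {f : ℂ → ℂ} {S : Set ℂ} (hS : IsClosed S)
    (hf : ContinuousOn f S) (h : Tendsto f (cocompact ℂ) (𝓝 0)) :
    ∃ C > 0, ∀ z ∈ S, ‖f z‖ ≤ C := by
  obtain ⟨K, hK, hK'⟩ := mem_cocompact.1 (h.eventually (Metric.ball_mem_nhds (0 : ℂ) one_pos))
  obtain ⟨C, hC⟩ := (hK.inter_right hS).exists_bound_of_continuousOn (hf.mono inter_subset_right)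
  refine ⟨max C 1, by positivity, fun z hz => ?_⟩
  by_cases hzK : z ∈ K
  · exact (hC z ⟨hzK, hz⟩).trans (le_max_left _ _)
  · have : f z ∈ Metric.ball (0 : ℂ) 1 := hK' hzK
    exact (mem_ball_zero_iff.1 this).le.trans (le_max_right _ _)

theorem isClosed_re_le (ρ : ℝ) : IsClosed {z : ℂ | z.re ≤ ρ} :=
  isClosed_le Complex.continuous_re continuous_const

/-- In a slightly enlarged left half-plane, stability gives `|r(z)| ≤ exp (L (Re z)⁺)`. -/
theorem exists_half_plane_bounds (hRK : IsAdmissible a b) :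
    ∃ ρ > (0 : ℝ), ∃ L > (0 : ℝ), ∃ Q > (0 : ℝ), ∀ z : ℂ, z.re ≤ ρ →
      (denom a).eval z ≠ 0 ∧ (∀ i, ‖q a b i z‖ ≤ Q) ∧
      ‖r a b z‖ ≤ Real.exp (L * max z.re 0) := by
  obtain ⟨ρ, hρ, hD⟩ := exists_denom_eval_ne_zero hRK
  obtain ⟨C, hC, hr⟩ := exists_norm_le_of_tendsto_cocompact (isClosed_re_le ρ)
    (fun z hz => (differentiableAt_r b (hD z hz)).continuousAt.continuousWithinAt) hRK.r_infty
  have hq := fun i => exists_norm_le_of_tendsto_cocompact (isClosed_re_le ρ)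
    (fun z hz => (differentiableAt_q b (hD z hz) i).continuousAt.continuousWithinAt)
    (tendsto_q_cocompact hRK i)
  choose Q hQ hq using hq
  refine ⟨ρ / 2, by positivity, C / (ρ / 2), by positivity, 1 + ∑ i, Q i,
    add_pos_of_pos_of_nonneg one_pos (Finset.sum_nonneg fun i _ => (hQ i).le), fun z hz => ?_⟩
  have hzρ : z.re ≤ ρ := by linarith
  refine ⟨hD z hzρ, fun i => ?_, ?_⟩
  · have := Finset.single_le_sum (f := Q) (fun i _ => (hQ i).le) (Finset.mem_univ i)
    linarith [hq i z hzρ]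
  rcases le_total z.re 0 with h0 | h0
  · simpa [h0] using hRK.norm_r_le_one z h0
  rw [max_eq_left h0]
  have hderiv : ∀ w ∈ {w : ℂ | w.re ≤ ρ / 2}, ‖deriv (fun z : ℂ => r a b z) w‖ ≤ C / (ρ / 2) := by
    intro w hw
    have hball : ∀ v ∈ Metric.closedBall w (ρ / 2), v.re ≤ ρ := by
      intro v hv
      have h1 : (v - w).re ≤ ‖v - w‖ := Complex.re_le_norm _
      rw [mem_closedBall_iff_norm] at hv
      simp only [Complex.sub_re, mem_ofPred_eq] at h1 hw
      linarith
    refine Complex.norm_deriv_le_of_forall_mem_sphere_norm_le (by positivity) ?_ fun v hv =>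
      hr v (hball v (Metric.sphere_subset_closedBall hv))
    refine DifferentiableOn.diffContOnCl fun v hv => ?_
    rw [closure_ball _ (by positivity)] at hv
    exact (differentiableAt_r b (hD v (hball v hv))).differentiableWithinAt
  have hmv := (convex_halfSpace_re_le (ρ / 2)).norm_image_sub_le_of_norm_deriv_le
    (f := fun z : ℂ => r a b z) (fun w hw => differentiableAt_r b (hD w (by
      simp only [mem_ofPred_eq] at hw; linarith))) hderiv
    (show (z - (z.re : ℂ)) ∈ {w : ℂ | w.re ≤ ρ / 2} by simp; positivity) hz
  have h1 := hRK.norm_r_le_one (z - (z.re : ℂ)) (by simp)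
  have h2 : ‖z - (z - (z.re : ℂ))‖ = z.re := by
    rw [sub_sub_cancel, Complex.norm_real, Real.norm_of_nonneg h0]
  rw [h2] at hmv
  have h3 := norm_le_norm_add_norm_sub' (r a b z) (r a b (z - (z.re : ℂ)))
  have h4 := Real.add_one_le_exp (C / (ρ / 2) * z.re)
  linarith

theorem eventually_denom_eval_ne_zero_cobounded (a : Matrix (Fin m) (Fin m) ℝ) :
    ∀ᶠ z in Bornology.cobounded ℂ, (denom a).eval z ≠ 0 := by
  have hb : Bornology.IsBounded ((denom a).roots.toFinset : Set ℂ) :=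
    (Finset.finite_toSet _).isBounded
  filter_upwards [Bornology.isBounded_def.1 hb] with z hz h0
  exact hz (by simpa [denom_ne_zero] using h0)

/-- Since `r` is rational and vanishes at infinity, it is `O(1/z)` there. -/
theorem exists_norm_r_le_div (hRK : IsAdmissible a b) :
    ∃ C > (0 : ℝ), ∃ R > (0 : ℝ), ∀ z : ℂ, R ≤ ‖z‖ → ‖r a b z‖ ≤ C / ‖z‖ := by
  set f : ℂ → ℂ := Function.update (fun y : ℂ => r a b y⁻¹) 0 0 with hf
  have hf' : ∀ y ≠ 0, f y = r a b y⁻¹ := fun y hy => Function.update_of_ne hy _ _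
  have hcont : ContinuousAt f 0 := by
    rw [hf, continuousAt_update_same]
    have := hRK.r_infty
    rw [← Metric.cobounded_eq_cocompact] at this
    exact this.comp tendsto_inv₀_nhdsNE_zero
  have hdiff : ∀ᶠ y in 𝓝[≠] (0 : ℂ), DifferentiableAt ℂ f y := by
    filter_upwards [tendsto_inv₀_nhdsNE_zero.eventually (eventually_denom_eval_ne_zero_cobounded a),
      self_mem_nhdsWithin] with y hy hy0
    have h : DifferentiableAt ℂ (fun y : ℂ => r a b y⁻¹) y :=
      (differentiableAt_r b hy).comp y (differentiableAt_inv hy0)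
    refine h.congr_of_eventuallyEq ?_
    filter_upwards [isOpen_ne.mem_nhds hy0] with w hw using hf' w hw
  have han := Complex.analyticAt_of_differentiable_on_punctured_nhds_of_continuousAt hdiff hcont
  obtain ⟨C, hC, hO⟩ := han.differentiableAt.isBigO_sub.exists_pos
  have hf0 : f 0 = 0 := Function.update_self _ _ _
  rw [Asymptotics.IsBigOWith] at hO
  simp only [hf0, sub_zero] at hO
  obtain ⟨δ, hδ, hball⟩ := Metric.eventually_nhds_iff_ball.1 hO
  refine ⟨C, hC, 2 / δ, by positivity, fun z hz => ?_⟩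
  have hz0 : 0 < ‖z‖ := lt_of_lt_of_le (by positivity) hz
  have h := hball z⁻¹ (by
    rw [mem_ball_zero_iff, norm_inv, inv_lt_comm₀ hz0 hδ]
    refine lt_of_lt_of_le ?_ hz
    rw [inv_eq_one_div]
    gcongr
    norm_num)
  rw [hf' _ (inv_ne_zero (norm_pos_iff.1 hz0)), inv_inv, norm_inv] at h
  rwa [div_eq_mul_inv]

/-- Strict stability in the open half-plane, by the maximum modulus principle. -/
theorem norm_r_lt_one (hRK : IsAdmissible a b) {z : ℂ} (hz : z.re < 0) : ‖r a b z‖ < 1 := by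
  refine lt_of_le_of_ne (hRK.norm_r_le_one z hz.le) fun h1 => ?_
  obtain ⟨ρ, hρ, hD⟩ := exists_denom_eval_ne_zero hRK
  have heq := Complex.eqOn_of_isPreconnected_of_isMaxOn_norm (f := fun z : ℂ => r a b z)
    (U := {w : ℂ | w.re < 0}) (c := z) (convex_halfSpace_re_lt 0).isPreconnected
    (isOpen_lt Complex.continuous_re continuous_const)
    (fun w hw => (differentiableAt_r b (hD w (le_trans (le_of_lt hw) hρ.le))).differentiableWithinAt)
    hz (fun w hw => by
      simpa [h1] using hRK.norm_r_le_one w (le_of_lt hw))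
  have ht : Tendsto (fun t : ℝ => (-t : ℂ)) atTop (cocompact ℂ) := by
    rw [← Metric.cobounded_eq_cocompact, ← tendsto_norm_atTop_iff_cobounded]
    simpa using tendsto_abs_atTop_atTop
  have hlim := (hRK.r_infty.comp ht).norm
  have hconst : ∀ᶠ t : ℝ in atTop, ‖r a b (-t : ℂ)‖ = 1 := by
    filter_upwards [eventually_gt_atTop 0] with t ht
    have := heq (x := (-t : ℂ)) (by simpa using ht)
    simp only [Function.const_apply] at this
    rw [this, h1]
  have := tendsto_nhds_unique hlim (tendsto_const_nhds.congr' (hconst.mono fun t ht => ht.symm))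
  simp at this

/-- Consistency gives the decay of `r` near the origin inside a sector. -/
theorem exists_norm_r_le_near_zero (hRK : IsAdmissible a b) {η : ℝ} (hη : 0 < η) :
    ∃ δ > (0 : ℝ), ∀ z : ℂ, z.re ≤ -(η * ‖z‖) → ‖z‖ < δ → ‖r a b z‖ ≤ 1 / (1 + η / 2 * ‖z‖) := by
  have hs : ContinuousAt (fun z : ℂ => ∑ i, q a b i z) 0 :=
    tendsto_finsetSum _ fun i _ => (differentiableAt_q b (by simp [denom_eval_zero]) i).continuousAt
  have hs0 : ∑ i, q a b i (0 : ℂ) = 1 := by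
    simp only [q_zero]
    exact_mod_cast hRK.consistent
  rw [ContinuousAt, hs0] at hs
  obtain ⟨δ, hδ, hball⟩ := Metric.eventually_nhds_iff_ball.1
    (hs.eventually (Metric.ball_mem_nhds (1 : ℂ) (show 0 < η / 4 by positivity)))
  refine ⟨min δ (min 1 (η / 2)), by positivity, fun z hz hzδ => ?_⟩
  have hz1 : ‖z‖ < δ := hzδ.trans_le (min_le_left _ _)
  have hz2 : ‖z‖ < 1 := hzδ.trans_le ((min_le_right _ _).trans (min_le_left _ _))
  have hz3 : ‖z‖ < η / 2 := hzδ.trans_le ((min_le_right _ _).trans (min_le_right _ _))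
  have hn := norm_nonneg z
  have h1 : ‖∑ i, q a b i z - 1‖ ≤ η / 4 := by
    have := hball z (by simpa using hz1)
    rw [dist_eq_norm] at this
    exact this.le
  have h2 : ‖r a b z‖ ≤ ‖1 + z‖ + ‖z‖ * (η / 4) := by
    have : r a b z = (1 + z) + z * (∑ i, q a b i z - 1) := by rw [r]; ring
    rw [this]
    refine (norm_add_le _ _).trans ?_
    rw [norm_mul]
    gcongr
  have hre : -‖z‖ ≤ z.re := (abs_le.1 (Complex.abs_re_le_norm z)).1
  have h3 : ‖1 + z‖ ≤ 1 + z.re + ‖z‖ ^ 2 / 2 := by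
    refine abs_le_of_sq_le_sq' ?_ (by nlinarith) |>.2
    have : ‖1 + z‖ ^ 2 = 1 + 2 * z.re + ‖z‖ ^ 2 := by
      rw [Complex.sq_norm, Complex.sq_norm, Complex.normSq_apply, Complex.normSq_apply]
      simp
      ring
    rw [this]
    nlinarith [sq_nonneg (z.re + ‖z‖ ^ 2 / 2)]
  have h4 : ‖r a b z‖ ≤ 1 - η / 2 * ‖z‖ := by nlinarith
  refine h4.trans ?_
  rw [le_div_iff₀ (by positivity)]
  nlinarith [sq_nonneg (η / 2 * ‖z‖)]

/-- Decay of the stability function in a sector around the negative real axis. -/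
theorem exists_norm_r_le_sector (hRK : IsAdmissible a b) {η : ℝ} (hη : 0 < η) :
    ∃ κ > (0 : ℝ), ∀ z : ℂ, z.re ≤ -(η * ‖z‖) → ‖r a b z‖ ≤ 1 / (1 + κ * ‖z‖) := by
  obtain ⟨δ, hδ, h0⟩ := exists_norm_r_le_near_zero hRK hη
  obtain ⟨C, hC, R, hR, hinf⟩ := exists_norm_r_le_div hRK
  obtain ⟨ρ, hρ, hD⟩ := exists_denom_eval_ne_zero hRK
  set S : Set ℂ := {z | z.re ≤ -(η * ‖z‖)} ∩ {z | δ ≤ ‖z‖} with hS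
  have hSc : IsClosed S := (isClosed_le (by fun_prop) (by fun_prop)).inter
    (isClosed_le (by fun_prop) (by fun_prop))
  set R' := max R (2 * C) with hR'
  have hR'pos : 0 < R' := lt_max_of_lt_left hR
  have hneg : ∀ z ∈ S, z.re < 0 := by
    intro z hz
    have h1 : z.re ≤ -(η * ‖z‖) := hz.1
    have h2 : δ ≤ ‖z‖ := hz.2
    have : 0 < η * ‖z‖ := mul_pos hη (hδ.trans_le h2)
    linarith
  obtain ⟨q₀, hq₀, hq₀1, hmid⟩ : ∃ q₀ > (0 : ℝ), q₀ < 1 ∧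
      ∀ z ∈ Metric.closedBall (0 : ℂ) R' ∩ S, ‖r a b z‖ ≤ q₀ := by
    rcases (Metric.closedBall (0 : ℂ) R' ∩ S).eq_empty_or_nonempty with he | hne
    · exact ⟨1 / 2, by norm_num, by norm_num, by simp [he]⟩
    · obtain ⟨w, hw, hmax⟩ := ((isCompact_closedBall (0 : ℂ) R').inter_right hSc).exists_isMaxOn hne
        (f := fun z : ℂ => ‖r a b z‖) (fun z hz => (differentiableAt_r b
          (hD z ((hneg z hz.2).le.trans hρ.le))).continuousAt.norm.continuousWithinAt)
      refine ⟨max ‖r a b w‖ (1 / 2), by positivity, max_lt (norm_r_lt_one hRK (hneg w hw.2))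
        (by norm_num), fun z hz => (hmax hz).trans (le_max_left _ _)⟩
  refine ⟨min (η / 2) (min (1 / (2 * C)) ((1 / q₀ - 1) / R')), ?_, fun z hz => ?_⟩
  · have : 0 < 1 / q₀ - 1 := by
      have := (one_lt_div hq₀).2 hq₀1
      linarith
    positivity
  set κ := min (η / 2) (min (1 / (2 * C)) ((1 / q₀ - 1) / R'))
  have hκ1 : κ ≤ η / 2 := min_le_left _ _
  have hκ2 : κ ≤ 1 / (2 * C) := (min_le_right _ _).trans (min_le_left _ _)
  have hκ3 : κ ≤ (1 / q₀ - 1) / R' := (min_le_right _ _).trans (min_le_right _ _)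
  have hκ0 : 0 < κ := by
    have : 0 < 1 / q₀ - 1 := by
      have := (one_lt_div hq₀).2 hq₀1
      linarith
    positivity
  rcases lt_or_ge ‖z‖ δ with h | h
  · refine (h0 z hz h).trans ?_
    gcongr
  rcases le_or_gt ‖z‖ R' with h' | h'
  · refine (hmid z ⟨by simpa using h', hz, h⟩).trans ?_
    rw [le_div_iff₀ (by positivity)]
    have h1 : κ * ‖z‖ ≤ 1 / q₀ - 1 := by
      have hnn : 0 ≤ (1 / q₀ - 1) / R' := hκ0.le.trans hκ3
      calc κ * ‖z‖ ≤ (1 / q₀ - 1) / R' * R' := by gcongr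
        _ = _ := by field_simp
    calc q₀ * (1 + κ * ‖z‖) ≤ q₀ * (1 + (1 / q₀ - 1)) := by gcongr
      _ = 1 := by field_simp; ring
  · have hz0 : 0 < ‖z‖ := hR'pos.trans h'
    refine (hinf z ((le_max_left _ _).trans h'.le)).trans ?_
    rw [div_le_div_iff₀ hz0 (by positivity)]
    have h1 : κ * C ≤ 1 / 2 := by
      calc κ * C ≤ 1 / (2 * C) * C := by gcongr
        _ = 1 / 2 := by field_simp
    have h2 : 2 * C ≤ ‖z‖ := (le_max_right _ _).trans h'.le
    nlinarith

end StabilityFunction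

/-! ### The hyperbola and the Cauchy integral over it -/

/-- The map `w ↦ ν (1 - sin w) + σ`, which sends the vertical line `Re w = α` to the hyperbola with
parameters `α`, `ν`, `σ`, and the lines `Re w = ± π / 2` to doubly covered real half-lines. -/
noncomputable def arc (ν σ : ℝ) (w : ℂ) : ℂ := ν * (1 - Complex.sin w) + σ

theorem hyperbola_eq_arc (α ν σ θ : ℝ) :
    hyperbola α ν σ θ = arc ν σ (α + θ * Complex.I) := by
  rw [hyperbola, arc, mul_comm Complex.I]

theorem sin_eq_mk (w : ℂ) : Complex.sin w
    = ⟨Real.sin w.re * Real.cosh w.im, Real.cos w.re * Real.sinh w.im⟩ := by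
  rw [Complex.mk_eq_add_mul_I, Complex.sin_eq]
  push_cast
  rfl

theorem cos_eq_mk (w : ℂ) : Complex.cos w
    = ⟨Real.cos w.re * Real.cosh w.im, -(Real.sin w.re * Real.sinh w.im)⟩ := by
  rw [Complex.mk_eq_add_mul_I, Complex.cos_eq]
  push_cast
  ring

theorem norm_one_sub_sin (w : ℂ) : ‖1 - Complex.sin w‖ = Real.cosh w.im - Real.sin w.re := by
  have h0 : 0 ≤ Real.cosh w.im - Real.sin w.re := by
    linarith [Real.one_le_cosh w.im, Real.sin_le_one w.re]
  rw [← sq_eq_sq₀ (norm_nonneg _) h0, Complex.sq_norm, Complex.normSq_apply]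
  simp only [Complex.sub_re, Complex.sub_im, Complex.one_re, Complex.one_im, sin_eq_mk]
  nlinarith [Real.sin_sq_add_cos_sq w.re, Real.cosh_sq w.im]

theorem norm_cos_sq (w : ℂ) :
    ‖Complex.cos w‖ ^ 2 = Real.cosh w.im ^ 2 - Real.sin w.re ^ 2 := by
  rw [Complex.sq_norm, Complex.normSq_apply, cos_eq_mk]
  simp only
  nlinarith [Real.sin_sq_add_cos_sq w.re, Real.cosh_sq w.im]

/-- The hyperbola is traversed at a speed comparable to the distance from its centre. -/
theorem norm_cos_le_mul_norm_one_sub_sin {w : ℂ} {s : ℝ} (hs : s < 1) (hw : Real.sin w.re ≤ s) :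
    ‖Complex.cos w‖ ≤ Real.sqrt (2 / (1 - s)) * ‖1 - Complex.sin w‖ := by
  have h1 : 0 < 1 - s := by linarith
  refine abs_le_of_sq_le_sq' ?_ (by positivity) |>.2
  rw [mul_pow, Real.sq_sqrt (by positivity), norm_one_sub_sin, norm_cos_sq, div_mul_eq_mul_div,
    le_div_iff₀ h1]
  have hc := Real.one_le_cosh w.im
  have hs' := Real.neg_one_le_sin w.re
  have hfac : 0 ≤ Real.cosh w.im - Real.sin w.re := by linarith
  have : (Real.cosh w.im + Real.sin w.re) * (1 - s) ≤ 2 * (Real.cosh w.im - Real.sin w.re) := by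
    nlinarith
  nlinarith [mul_le_mul_of_nonneg_left this hfac]

theorem abs_arg_le_of_re_ge {z : ℂ} {φ : ℝ} (hz : z ≠ 0) (hφ : φ ≤ Real.pi)
    (h : -(Real.cos φ * ‖z‖) ≤ z.re) : |z.arg| ≤ Real.pi - φ := by
  by_contra! hn
  have hlt := Real.cos_lt_cos_of_nonneg_of_le_pi (sub_nonneg.2 hφ) (Complex.abs_arg_le_pi z) hn
  rw [Real.cos_abs, Complex.cos_arg hz, Real.cos_pi_sub, div_lt_iff₀ (norm_pos_iff.2 hz)] at hlt
  linarith

theorem arc_sub (ν σ : ℝ) (w : ℂ) : arc ν σ w - σ = ν * (1 - Complex.sin w) := by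
  rw [arc, add_sub_cancel_right]

theorem norm_arc_sub {ν : ℝ} (hν : 0 < ν) (σ : ℝ) (w : ℂ) :
    ‖arc ν σ w - σ‖ = ν * (Real.cosh w.im - Real.sin w.re) := by
  rw [arc_sub, norm_mul, Complex.norm_real, Real.norm_of_nonneg hν.le, norm_one_sub_sin]

theorem arc_re (ν σ : ℝ) (w : ℂ) :
    (arc ν σ w).re = ν * (1 - Real.sin w.re * Real.cosh w.im) + σ := by
  simp [arc, sin_eq_mk]

/-- The hyperbolas with parameter `Re w ∈ [-π/2, π/2 - φ)` lie in the sector of a sectorial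
operator of angle `φ`. -/
theorem arc_mem_sector {ν σ φ : ℝ} {w : ℂ} (hν : 0 < ν) (hφ0 : 0 ≤ φ) (hφ : φ < Real.pi / 2)
    (h1 : -(Real.pi / 2) ≤ w.re) (h2 : w.re < Real.pi / 2 - φ) :
    arc ν σ w ≠ σ ∧ |(arc ν σ w - σ).arg| ≤ Real.pi - φ := by
  have hc := Real.one_le_cosh w.im
  have hs : Real.sin w.re < Real.cos φ := by
    rw [← Real.sin_pi_div_two_sub]
    exact Real.sin_lt_sin_of_lt_of_le_pi_div_two h1 (by linarith) h2
  have hcφ := Real.cos_le_one φ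
  have hpos : 0 < ‖arc ν σ w - σ‖ := by
    rw [norm_arc_sub hν]
    exact mul_pos hν (by linarith)
  refine ⟨sub_ne_zero.1 (norm_pos_iff.1 hpos), abs_arg_le_of_re_ge (norm_pos_iff.1 hpos)
    (by linarith [Real.pi_pos]) ?_⟩
  rw [norm_arc_sub hν, Complex.sub_re, arc_re, Complex.ofReal_re, add_sub_cancel_right]
  have hcp : 0 < Real.cos φ := Real.cos_pos_of_mem_Ioo ⟨by linarith, hφ⟩
  have : 0 ≤ (1 - Real.sin w.re * Real.cosh w.im)
      + Real.cos φ * (Real.cosh w.im - Real.sin w.re) := by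
    nlinarith
  nlinarith [mul_nonneg hν.le this]

theorem differentiable_arc (ν σ : ℝ) : Differentiable ℂ (arc ν σ) := by
  unfold arc
  fun_prop

/-- The hyperbolas run to infinity uniformly in `Re w`. -/
theorem tendsto_arc_cobounded {ν : ℝ} (hν : 0 < ν) (σ : ℝ) {l : Filter ℝ}
    (hl : Tendsto (fun y => |y|) l atTop) :
    Tendsto (arc ν σ) (comap Complex.im l) (Bornology.cobounded ℂ) := by
  rw [← tendsto_norm_atTop_iff_cobounded]
  have h1 : Tendsto (fun w : ℂ => |w.im|) (comap Complex.im l) atTop := hl.comp tendsto_comap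
  have h2 : Tendsto (fun w : ℂ => ν * (|w.im| - 1) - |σ|) (comap Complex.im l) atTop :=
    tendsto_atTop_add_const_right _ _
      ((tendsto_atTop_add_const_right _ (-1 : ℝ) h1).const_mul_atTop hν)
  refine tendsto_atTop_mono (fun w => ?_) h2
  have h3 := norm_sub_le (arc ν σ w) σ
  rw [norm_arc_sub hν, Complex.norm_real, Real.norm_eq_abs] at h3
  have h4 : |w.im| ≤ Real.cosh w.im := by
    rw [← Real.cosh_abs]
    have := Real.self_le_sinh_iff.2 (abs_nonneg w.im)
    exact this.trans (Real.sinh_lt_cosh _).le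
  have h5 := Real.sin_le_one w.re
  have : ν * (|w.im| - 1) ≤ ν * (Real.cosh w.im - Real.sin w.re) := by gcongr
  linarith

section IntegralRepresentation

variable {R : Type*} [NormedRing R] [NormedAlgebra ℂ R]

theorem tendsto_smul_resolvent [CompleteSpace R] (Z : R) :
    Tendsto (fun z : ℂ => z • resolvent Z z) (Bornology.cobounded ℂ) (𝓝 1) := by
  have h : Tendsto (fun z : ℂ => 1 + Z * resolvent Z z) (Bornology.cobounded ℂ) (𝓝 1) := by
    simpa using ((spectrum.resolvent_tendsto_cobounded (𝕜 := ℂ) Z).const_mul Z).const_add 1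
  refine h.congr' ?_
  filter_upwards [spectrum.eventually_isUnit_resolvent (𝕜 := ℂ) Z] with z hz
  have hu : IsUnit (algebraMap ℂ R z - Z) := spectrum.isUnit_resolvent.2 hz
  have := Ring.mul_inverse_cancel _ hu
  rw [sub_mul, ← Algebra.smul_def] at this
  rw [← this]
  exact sub_add_cancel _ _

/-- With `γ = arc ν σ`, `ν cos w (γ(w) - Z)⁻¹` tends to a constant along each end of the hyperbolas;
`ε` is `i` for `Im w → ∞` and `-i` for `Im w → -∞`. -/
theorem tendsto_cos_smul_resolvent [CompleteSpace R] (Z : R) {ν σ : ℝ} {l : Filter ℂ} {ε : ℂ}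
    (hl : Tendsto (arc ν σ) l (Bornology.cobounded ℂ))
    (hexp : ∀ᶠ w in l, ‖Complex.cos w + ε * Complex.sin w‖ ≤ 1) :
    Tendsto (fun w => (ν * Complex.cos w) • resolvent Z (arc ν σ w)) l (𝓝 (ε • 1)) := by
  have h1 := ((tendsto_smul_resolvent Z).comp hl).const_smul ε
  have h2 := (spectrum.resolvent_tendsto_cobounded (𝕜 := ℂ) Z).comp hl
  have h3 : Tendsto (fun w => (ν * (Complex.cos w + ε * Complex.sin w) - ε * (ν + σ)) •
      resolvent Z (arc ν σ w)) l (𝓝 0) := by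
    have hb : ∀ᶠ w in l, ‖(ν * (Complex.cos w + ε * Complex.sin w) - ε * (ν + σ))‖
        ≤ |ν| + ‖ε * (ν + σ)‖ := by
      filter_upwards [hexp] with w hw
      refine (norm_sub_le _ _).trans ?_
      rw [norm_mul, Complex.norm_real, Real.norm_eq_abs]
      nlinarith [abs_nonneg ν]
    have h2n := h2.norm
    rw [norm_zero] at h2n
    have h4 := h2n.const_mul (|ν| + ‖ε * (ν + σ)‖)
    rw [mul_zero] at h4
    refine squeeze_zero_norm' ?_ h4
    filter_upwards [hb] with w hw
    rw [norm_smul]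
    exact mul_le_mul_of_nonneg_right hw (norm_nonneg _)
  have := h1.add h3
  rw [add_zero] at this
  refine this.congr fun w => ?_
  simp only [Function.comp_apply, smul_smul, ← add_smul]
  congr 1
  rw [arc]
  ring

/-- The contribution of a horizontal segment moving off to infinity. -/
theorem tendsto_integral_horizontal [CompleteSpace R] {G : ℂ → R} {c : R} {p q : ℝ} {l : Filter ℝ}
    [l.IsCountablyGenerated] (hG : Tendsto G (comap Complex.im l ⊓ 𝓟 {w | w.re ∈ uIcc p q}) (𝓝 c))
    (hc : ContinuousOn G {w | w.re ∈ uIcc p q}) :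
    Tendsto (fun y : ℝ => ∫ x in p..q, G (x + y * Complex.I)) l (𝓝 ((q - p) • c)) := by
  rw [← intervalIntegral.integral_const]
  have hev : ∀ᶠ y : ℝ in l, ∀ x : ℝ, x ∈ uIcc p q → ‖G (x + y * Complex.I)‖ ≤ ‖c‖ + 1 := by
    have := (hG.norm.eventually (eventually_le_nhds (lt_add_one ‖c‖)))
    rw [eventually_inf_principal, eventually_comap] at this
    filter_upwards [this] with y hy x hx
    exact hy _ (by simp) (by simpa using hx)
  refine intervalIntegral.tendsto_integral_filter_of_dominated_convergence (fun _ => ‖c‖ + 1)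
    ?_ ?_ intervalIntegrable_const ?_
  · refine Eventually.of_forall fun y => ?_
    refine ContinuousOn.aestronglyMeasurable ?_ measurableSet_uIoc
    refine hc.comp (by fun_prop) fun x hx => ?_
    simpa using uIoc_subset_uIcc hx
  · filter_upwards [hev] with y hy
    exact Eventually.of_forall fun x hx => hy x (uIoc_subset_uIcc hx)
  · refine Eventually.of_forall fun x hx => hG.comp ?_
    rw [tendsto_inf, tendsto_comap_iff, tendsto_principal]
    refine ⟨?_, Eventually.of_forall fun y => ?_⟩
    · have : Tendsto (fun y : ℝ => y) l l := tendsto_id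
      simpa [Function.comp_def] using this
    · simpa using uIoc_subset_uIcc hx

/-- On the lines `Re w = ± π / 2` the hyperbola is folded onto a half-line, and the integral over it
vanishes by symmetry. -/
theorem integral_folded_eq_zero {ν σ e : ℝ} (he : Real.cos e = 0) (f : ℂ → R) (T : ℝ) :
    ∫ y in (-T)..T, (ν * Complex.cos (e + y * Complex.I)) • f (arc ν σ (e + y * Complex.I)) = 0 := by
  set g : ℝ → R := fun y => (ν * Complex.cos (e + y * Complex.I)) • f (arc ν σ (e + y * Complex.I))
  have he' : Complex.cos e = 0 := by rw [← Complex.ofReal_cos, he, Complex.ofReal_zero]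
  have hodd : ∀ y, g (-y) = -g y := by
    intro y
    have h1 : Complex.cos (e + (-y : ℝ) * Complex.I) = -Complex.cos (e + y * Complex.I) := by
      simp [Complex.cos_add, he']
    have h2 : Complex.sin (e + (-y : ℝ) * Complex.I) = Complex.sin (e + y * Complex.I) := by
      simp [Complex.sin_add, he']
    simp only [g, arc, h1, h2, mul_neg, neg_smul]
  have h := intervalIntegral.integral_comp_neg (a := -T) (b := T) g
  simp only [hodd, intervalIntegral.integral_neg, neg_neg] at h
  have : (2 : ℝ) • ∫ y in (-T)..T, g y = 0 := by
    rw [two_smul]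
    nth_rewrite 1 [← h]
    exact neg_add_cancel _
  exact (smul_eq_zero_iff_right two_ne_zero).1 this

theorem rectangle_identity {G : ℂ → R} {p q : ℝ}
    (hG : DifferentiableOn ℂ G {w | w.re ∈ uIcc p q}) (T : ℝ) :
    (∫ x in p..q, G (x + (-T : ℝ) * Complex.I)) - (∫ x in p..q, G (x + T * Complex.I))
      + Complex.I • (∫ y in (-T)..T, G (q + y * Complex.I))
      - Complex.I • (∫ y in (-T)..T, G (p + y * Complex.I)) = 0 := by
  have := Complex.integral_boundary_rect_eq_zero_of_differentiableOn G (p + (-T : ℝ) * Complex.I)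
    (q + T * Complex.I) (hG.mono fun z hz => by simpa using hz.1)
  simpa using this

/-- The Cauchy integral over the hyperbola reproduces `F(Z)`. The integrand is split as
`F(z) (z - Z)⁻¹ = F(Z) (z - Z)⁻¹ + S(z)`. The first summand is analytic to the right of the
hyperbola and the second one to the left. Each is deformed to a folded hyperbola, where its integral
vanishes, and only the ends of the rectangles at infinity contribute. -/
theorem tendsto_integral_hyperbola [CompleteSpace R] {Z FZ : R} {ν σ α ρ : ℝ} {F : ℂ → ℂ} {S : ℂ → R} (hν : 0 < ν)
    (hα1 : -(Real.pi / 2) ≤ α) (hα2 : α ≤ Real.pi / 2)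
    (hres : ∀ w : ℂ, -(Real.pi / 2) ≤ w.re → w.re ≤ α → arc ν σ w ∈ resolventSet ℂ Z)
    (hre : ∀ w : ℂ, α ≤ w.re → w.re ≤ Real.pi / 2 → (arc ν σ w).re ≤ ρ)
    (hS : ∀ z : ℂ, z.re ≤ ρ → DifferentiableAt ℂ S z)
    (hF : Tendsto F (Bornology.cobounded ℂ ⊓ 𝓟 {z | z.re ≤ ρ}) (𝓝 0))
    (hsplit : ∀ z ∈ resolventSet ℂ Z, z.re ≤ ρ →
      F z • resolvent Z z = FZ * resolvent Z z + S z) :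
    Tendsto (fun T : ℝ => ∫ y in (-T)..T,
      (ν * Complex.cos (α + y * Complex.I)) • F (arc ν σ (α + y * Complex.I)) •
        resolvent Z (arc ν σ (α + y * Complex.I))) atTop (𝓝 ((2 * Real.pi) • FZ)) := by
  set G₁ : ℂ → R := fun w => (ν * Complex.cos w) • (FZ * resolvent Z (arc ν σ w)) with hG₁
  set G₂ : ℂ → R := fun w => (ν * Complex.cos w) • S (arc ν σ w) with hG₂
  have hd₁ : DifferentiableOn ℂ G₁ {w | w.re ∈ uIcc (-(Real.pi / 2)) α} := by
    intro w hw
    rw [mem_ofPred_eq, uIcc_of_le hα1] at hw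
    have h1 := (spectrum.hasDerivAt_resolvent_const_left (hres w hw.1 hw.2)).differentiableAt.comp w
      (differentiable_arc ν σ w)
    have h2 : DifferentiableAt ℂ (fun w => ν * Complex.cos w) w := by fun_prop
    exact (h2.smul (h1.const_mul FZ)).differentiableWithinAt
  have hd₂ : DifferentiableOn ℂ G₂ {w | w.re ∈ uIcc α (Real.pi / 2)} := by
    intro w hw
    rw [mem_ofPred_eq, uIcc_of_le hα2] at hw
    have h1 := (hS _ (hre w hw.1 hw.2)).comp w (differentiable_arc ν σ w)
    have h2 : DifferentiableAt ℂ (fun w => ν * Complex.cos w) w := by fun_prop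
    exact (h2.smul h1).differentiableWithinAt
  -- the limits of `G₁` and `G₂` at both ends
  have hends : ∀ l : Filter ℝ, ∀ ε : ℂ, Tendsto (fun y => |y|) l atTop →
      (∀ᶠ w in comap Complex.im l, ‖Complex.cos w + ε * Complex.sin w‖ ≤ 1) →
      Tendsto G₁ (comap Complex.im l ⊓ 𝓟 {w | w.re ∈ uIcc (-(Real.pi / 2)) α}) (𝓝 (ε • FZ)) ∧
      Tendsto G₂ (comap Complex.im l ⊓ 𝓟 {w | w.re ∈ uIcc α (Real.pi / 2)}) (𝓝 (-(ε • FZ))) := by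
    intro l ε hl hexp
    have harc := tendsto_arc_cobounded hν σ hl
    have h := tendsto_cos_smul_resolvent Z harc hexp
    have h1 : Tendsto G₁ (comap Complex.im l) (𝓝 (ε • FZ)) := by
      have := h.const_mul FZ
      simpa [hG₁, mul_smul_comm] using this
    refine ⟨h1.mono_left inf_le_left, ?_⟩
    have harc' : Tendsto (arc ν σ) (comap Complex.im l ⊓ 𝓟 {w | w.re ∈ uIcc α (Real.pi / 2)})
        (Bornology.cobounded ℂ ⊓ 𝓟 {z | z.re ≤ ρ}) := by
      refine tendsto_inf.2 ⟨harc.mono_left inf_le_left, tendsto_principal.2 ?_⟩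
      rw [eventually_inf_principal]
      refine Eventually.of_forall fun w hw => ?_
      rw [mem_ofPred_eq, uIcc_of_le hα2] at hw
      exact hre w hw.1 hw.2
    have h2 := ((hF.comp harc').smul (h.mono_left inf_le_left)).sub (h1.mono_left inf_le_left)
    rw [zero_smul, zero_sub] at h2
    refine h2.congr' ?_
    filter_upwards [harc'.eventually (eventually_inf_principal.2 (Eventually.of_forall
        fun z hz => hz)), (harc.mono_left inf_le_left).eventually
        (spectrum.eventually_isUnit_resolvent (𝕜 := ℂ) Z)] with w hw hu
    have := hsplit _ (spectrum.isUnit_resolvent.2 hu) hw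
    simp only [hG₁, hG₂, Function.comp_apply]
    rw [smul_comm, this, smul_add, add_sub_cancel_left]
  obtain ⟨ht₁, ht₂⟩ := hends atTop Complex.I tendsto_abs_atTop_atTop (by
    filter_upwards [tendsto_comap.eventually (eventually_ge_atTop 0)] with w hw
    rw [mul_comm, ← Complex.exp_mul_I, Complex.norm_exp, Real.exp_le_one_iff]
    simpa using hw)
  obtain ⟨hb₁, hb₂⟩ := hends atBot (-Complex.I)
    tendsto_abs_atBot_atTop (by
    filter_upwards [tendsto_comap.eventually (eventually_le_atBot 0)] with w hw
    have : Complex.cos w + -Complex.I * Complex.sin w = Complex.exp (-w * Complex.I) := by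
      rw [Complex.exp_mul_I, Complex.cos_neg, Complex.sin_neg]
      ring
    rw [this, Complex.norm_exp, Real.exp_le_one_iff]
    simpa using hw)
  have i₁ := fun T => rectangle_identity hd₁ T
  have i₂ := fun T => rectangle_identity hd₂ T
  have hf₁ : ∀ T : ℝ, ∫ y in (-T)..T, G₁ ((-(Real.pi / 2) : ℝ) + y * Complex.I) = 0 := fun T =>
    integral_folded_eq_zero (by simp) (fun z => FZ * resolvent Z z) T
  have hf₂ : ∀ T : ℝ, ∫ y in (-T)..T, G₂ ((Real.pi / 2 : ℝ) + y * Complex.I) = 0 := fun T =>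
    integral_folded_eq_zero (by simp) S T
  have L₁ := (tendsto_integral_horizontal ht₁ hd₁.continuousOn).sub
    ((tendsto_integral_horizontal hb₁ hd₁.continuousOn).comp tendsto_neg_atTop_atBot)
  have L₂ := ((tendsto_integral_horizontal hb₂ hd₂.continuousOn).comp tendsto_neg_atTop_atBot).sub
    (tendsto_integral_horizontal ht₂ hd₂.continuousOn)
  have L := (L₁.add L₂).const_smul (-Complex.I)
  have hval : -Complex.I • ((α - -(Real.pi / 2)) • Complex.I • FZ
      - (α - -(Real.pi / 2)) • -Complex.I • FZ + ((Real.pi / 2 - α) • -(-Complex.I • FZ)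
      - (Real.pi / 2 - α) • -(Complex.I • FZ))) = (2 * Real.pi) • FZ := by
    simp only [← Complex.coe_smul]
    match_scalars
    linear_combination (-2 * (Real.pi : ℂ)) * Complex.I_sq
  rw [hval] at L
  refine L.congr fun T => ?_
  have hline₁ : IntervalIntegrable (fun y : ℝ => G₁ (α + y * Complex.I)) volume (-T) T :=
    (hd₁.continuousOn.comp_continuous (by fun_prop) fun y => by simp).intervalIntegrable _ _
  have hline₂ : IntervalIntegrable (fun y : ℝ => G₂ (α + y * Complex.I)) volume (-T) T :=
    (hd₂.continuousOn.comp_continuous (by fun_prop) fun y => by simp).intervalIntegrable _ _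
  have hsum : ∫ y in (-T)..T,
      (ν * Complex.cos (α + y * Complex.I)) • F (arc ν σ (α + y * Complex.I)) •
        resolvent Z (arc ν σ (α + y * Complex.I))
      = (∫ y in (-T)..T, G₁ (α + y * Complex.I)) + ∫ y in (-T)..T, G₂ (α + y * Complex.I) := by
    rw [← intervalIntegral.integral_add hline₁ hline₂]
    refine intervalIntegral.integral_congr fun y _ => ?_
    simp only [hG₁, hG₂]
    rw [hsplit _ (hres _ (by simpa using hα1) (by simp)) (hre _ (by simp) (by simpa using hα2)),
      smul_add]
  rw [hsum]
  have e₁ := i₁ T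
  have e₂ := i₂ T
  rw [hf₁, smul_zero, sub_zero] at e₁
  rw [hf₂, smul_zero, add_zero] at e₂
  have e₁' : Complex.I • (∫ y in (-T)..T, G₁ (α + y * Complex.I))
      = (∫ x in (-(Real.pi / 2))..α, G₁ (x + T * Complex.I))
        - ∫ x in (-(Real.pi / 2))..α, G₁ (x + (-T : ℝ) * Complex.I) := by
    rw [← sub_eq_zero, ← e₁]
    abel
  have e₂' : Complex.I • (∫ y in (-T)..T, G₂ (α + y * Complex.I))
      = (∫ x in α..(Real.pi / 2), G₂ (x + (-T : ℝ) * Complex.I))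
        - ∫ x in α..(Real.pi / 2), G₂ (x + T * Complex.I) := by
    rw [eq_comm, ← sub_eq_zero, ← e₂]
  simp only [Function.comp_apply]
  rw [← e₁', ← e₂', ← smul_add, smul_smul]
  simp

end IntegralRepresentation

/-! ### Truncation and decay along the hyperbola -/

/-- The error of the truncated trapezoidal rule: discretization error plus truncation error. -/
theorem norm_sub_truncated_trapezoid_le {V : Type*} [NormedAddCommGroup V] [NormedSpace ℂ V]
    [CompleteSpace V] {g : ℂ → V} {v : V} {d b t τ : ℝ} {K : ℕ} (hτ : 0 < τ) (hd : 0 < d)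
    (ht : 0 ≤ t) (hg : DifferentiableOn ℂ g {z | |z.im| ≤ d})
    (hb : ∀ z : ℂ, |z.im| ≤ d → ‖g z‖ ≤ b * Real.exp (-|z.re|))
    (hv : Tendsto (fun T : ℝ => ∫ x in (-T)..T, g x) atTop (𝓝 v))
    (htail : ∀ x : ℝ, K * τ ≤ |x| → ‖g x‖ ≤ t * Real.exp (-|x|)) :
    ‖v - ∑ k ∈ Finset.Icc (-(K : ℤ)) K, (τ : ℂ) • g (k * τ)‖
      ≤ 4 * b / (Real.exp (2 * Real.pi * d / τ) - 1) + t * (τ + 2) := by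
  obtain ⟨hsum, herr⟩ := norm_trapezoid_sub_integral_le hτ hd hg hb
  have hint : Integrable fun x : ℝ => g x := by
    refine ((integrable_exp_neg_mul_abs one_pos).const_mul b).mono' ?_ ?_
    · exact Continuous.aestronglyMeasurable (hg.continuousOn.comp_continuous (by fun_prop)
        fun x => by simpa using hd.le)
    · refine Eventually.of_forall fun x => ?_
      simpa using hb x (by simpa using hd.le)
  have hv' : v = ∫ x : ℝ, g x := tendsto_nhds_unique hv
    (intervalIntegral_tendsto_integral hint tendsto_neg_atTop_atBot tendsto_id)
  set s := Finset.Icc (-(K : ℤ)) K with hs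
  have hx1 : Real.exp (-τ) < 1 := by simpa using hτ
  have hgeo := (hasSum_int_geometric_natAbs (Real.exp_pos (-τ)).le hx1).mul_left (t * τ)
  -- the tail is dominated by a geometric series
  have htail' : ‖∑' k : ℤ, (τ : ℂ) • g (k * τ) - ∑ k ∈ s, (τ : ℂ) • g (k * τ)‖
      ≤ t * τ * ((1 + Real.exp (-τ)) / (1 - Real.exp (-τ))) := by
    have hind : HasSum (fun k : ℤ => if k ∈ s then 0 else (τ : ℂ) • g (k * τ))
        (∑' k : ℤ, (τ : ℂ) • g (k * τ) - ∑ k ∈ s, (τ : ℂ) • g (k * τ)) := by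
      have h1 : HasSum (fun k : ℤ => if k ∈ s then (τ : ℂ) • g (k * τ) else 0)
          (∑ k ∈ s, (τ : ℂ) • g (k * τ)) := by
        have : HasSum (fun k : ℤ => if k ∈ s then (τ : ℂ) • g (k * τ) else 0)
            (∑ k ∈ s, if k ∈ s then (τ : ℂ) • g (k * τ) else 0) :=
          hasSum_sum_of_ne_finset_zero fun k hk => if_neg hk
        rwa [Finset.sum_congr rfl fun k hk => if_pos hk] at this
      refine (hsum.hasSum.sub h1).congr_fun ?_
      intro k
      split_ifs <;> simp
    refine hind.tsum_eq ▸ tsum_of_norm_bounded hgeo fun k => ?_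
    split_ifs with hk
    · rw [norm_zero]
      positivity
    · have habs : (K : ℝ) ≤ |(k : ℝ)| := by
        have : ((K : ℤ) : ℝ) ≤ ((|k| : ℤ) : ℝ) := by
          refine Int.cast_le.2 ?_
          rw [hs, Finset.mem_Icc, ← abs_le] at hk
          omega
        simpa using this
      have := htail (k * τ) (by rw [abs_mul, abs_of_pos hτ]; gcongr)
      rw [norm_smul, Complex.norm_real, Real.norm_of_nonneg hτ.le, mul_comm t τ, mul_assoc]
      gcongr
      push_cast at this
      refine this.trans (le_of_eq ?_)
      congr 1
      rw [← Real.exp_nat_mul]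
      congr 1
      rw [abs_mul, abs_of_pos hτ, Nat.cast_natAbs]
      push_cast
      ring
  have hτ2 : τ * ((1 + Real.exp (-τ)) / (1 - Real.exp (-τ))) ≤ τ + 2 := by
    have h1 : 0 < 1 - Real.exp (-τ) := by linarith
    rw [← mul_div_assoc, div_le_iff₀ h1]
    have h2 : (1 + τ) * Real.exp (-τ) ≤ 1 := by
      rw [Real.exp_neg, mul_inv_le_iff₀ (Real.exp_pos _)]
      linarith [Real.add_one_le_exp τ]
    nlinarith
  calc ‖v - ∑ k ∈ s, (τ : ℂ) • g (k * τ)‖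
      = ‖(∑' k : ℤ, (τ : ℂ) • g (k * τ) - ∑ k ∈ s, (τ : ℂ) • g (k * τ))
        - (∑' k : ℤ, (τ : ℂ) • g (k * τ) - ∫ x : ℝ, g x)‖ := by
          rw [hv', sub_sub_sub_cancel_left]
    _ ≤ t * τ * ((1 + Real.exp (-τ)) / (1 - Real.exp (-τ)))
        + 4 * b / (Real.exp (2 * Real.pi * d / τ) - 1) :=
          (norm_sub_le _ _).trans (add_le_add htail' herr)
    _ ≤ _ := by
          rw [add_comm, mul_assoc t τ]
          exact add_le_add_right (mul_le_mul_of_nonneg_left hτ2 ht) _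

section ScalarDecay

variable {m : ℕ} {a : Matrix (Fin m) (Fin m) ℝ} {b : Fin m → ℝ}

/-- The behaviour of the stability function along all hyperbolas with `sin (Re w) ≥ s₀` whose
parameters satisfy `ς ≤ Λ ν`: growth at most `exp (L ν (1 + Λ))`, and decay beyond a parameter value
`X` that depends on `Λ`. The constants `ρ`, `L`, `Q` and `u` do not depend on `Λ`. -/
theorem exists_bounds_on_arc (hRK : IsAdmissible a b) {s₀ : ℝ} (hs₀ : 0 < s₀) :
    ∃ ρ > (0 : ℝ), ∃ L > (0 : ℝ), ∃ Q > (0 : ℝ), ∃ u > (0 : ℝ),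
      (∀ z : ℂ, z.re ≤ ρ → (denom a).eval z ≠ 0 ∧ ∀ i, ‖q a b i z‖ ≤ Q) ∧
      ∀ Λ ≥ (0 : ℝ), ∃ X ≥ (0 : ℝ), ∀ ν ς : ℝ, 0 < ν → ς ≤ Λ * ν → ν + max ς 0 ≤ ρ →
      ∀ w : ℂ, s₀ ≤ Real.sin w.re →
        (arc ν ς w).re ≤ ρ ∧
        ‖r a b (arc ν ς w)‖ ≤ Real.exp (L * (ν * (1 + Λ))) ∧
        (X ≤ |w.im| → ‖r a b (arc ν ς w)‖ ≤ 1 / (1 + u * ν * Real.exp |w.im|)) := by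
  obtain ⟨ρ, hρ, L, hL, Q, hQ, hb⟩ := exists_half_plane_bounds hRK
  obtain ⟨κ, hκ, hsec⟩ := exists_norm_r_le_sector hRK (η := s₀ / 4) (by positivity)
  refine ⟨ρ, hρ, L, hL, Q, hQ, κ * s₀ / 4, by positivity,
    fun z hz => ⟨(hb z hz).1, (hb z hz).2.1⟩, fun Λ hΛ => ?_⟩
  refine ⟨max 0 (Real.log (4 * (1 + Λ) / s₀)), le_max_left _ _, fun ν ς hν hς hνς w hw => ?_⟩
  have hc := Real.one_le_cosh w.im
  have hs1 := Real.sin_le_one w.re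
  have hre : (arc ν ς w).re ≤ ν * (1 - s₀ * Real.cosh w.im) + ς := by
    rw [arc_re]
    gcongr
  have hre' : (arc ν ς w).re ≤ ν + max ς 0 := by
    have : 0 ≤ ν * (s₀ * Real.cosh w.im) := by positivity
    linarith [le_max_left ς 0]
  refine ⟨hre'.trans hνς, ?_, fun hX => ?_⟩
  · refine (hb _ (hre'.trans hνς)).2.2.trans ?_
    gcongr
    have h1 : max ς 0 ≤ Λ * ν := max_le hς (by positivity)
    refine max_le (by linarith) (by positivity)
  · have hexp : 4 * (1 + Λ) / s₀ ≤ Real.exp |w.im| := by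
      rw [← Real.exp_log (show 0 < 4 * (1 + Λ) / s₀ by positivity)]
      exact Real.exp_le_exp.2 ((le_max_right _ _).trans hX)
    have hcosh : Real.exp |w.im| / 2 ≤ Real.cosh w.im := by
      rw [← Real.cosh_abs, Real.cosh_eq]
      have := Real.exp_pos (-|w.im|)
      linarith
    have hΛc : 2 * (1 + Λ) ≤ s₀ * Real.cosh w.im := by
      rw [div_le_iff₀ hs₀] at hexp
      nlinarith
    have hs₀1 : s₀ ≤ 1 := hw.trans hs1
    have hnorm : ‖arc ν ς w‖ ≤ ν * Real.cosh w.im + |ς| := by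
      have h1 := norm_le_norm_sub_add (arc ν ς w) (ς : ℂ)
      rw [norm_arc_sub hν, Complex.norm_real, Real.norm_eq_abs] at h1
      have : ν * (Real.cosh w.im - Real.sin w.re) ≤ ν * Real.cosh w.im := by
        gcongr
        linarith
      linarith
    have hre2 : (arc ν ς w).re ≤ -(ν * (s₀ * Real.cosh w.im) / 2) - ν * Λ + ς := by
      nlinarith
    have hpos : 0 < ν * Real.cosh w.im := by positivity
    have hsector : (arc ν ς w).re ≤ -(s₀ / 4 * ‖arc ν ς w‖) := by
      have h1 : s₀ / 4 * ‖arc ν ς w‖ ≤ s₀ / 4 * (ν * Real.cosh w.im + |ς|) := by gcongr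
      rcases le_total 0 ς with h0 | h0
      · rw [abs_of_nonneg h0] at h1
        have h2 : ς ≤ ν * Real.cosh w.im := by nlinarith
        have h3 : s₀ / 4 * ς ≤ s₀ / 4 * (ν * Real.cosh w.im) := by gcongr
        nlinarith
      · rw [abs_of_nonpos h0] at h1
        have h2 : 0 ≤ ν * Λ := by positivity
        nlinarith
    have hlow : s₀ / 4 * (ν * Real.exp |w.im|) ≤ ‖arc ν ς w‖ := by
      have h1 := (abs_le.1 (Complex.abs_re_le_norm (arc ν ς w))).1
      have h2 : ν * (s₀ * (Real.exp |w.im| / 2)) ≤ ν * (s₀ * Real.cosh w.im) := by gcongr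
      linarith
    refine (hsec _ hsector).trans ?_
    refine one_div_le_one_div_of_le (by positivity) ?_
    have := mul_le_mul_of_nonneg_left hlow hκ.le
    linarith

end ScalarDecay

theorem one_div_one_add_pow_le {n : ℕ} {y δ e : ℝ} (hδ : 0 < δ) (he : 0 < e) (hy : 0 ≤ y)
    (h : δ * e ≤ n * y) : (1 / (1 + y)) ^ n ≤ 1 / δ * e⁻¹ := by
  rw [one_div_pow, ← one_div, one_div_mul_one_div]
  refine one_div_le_one_div_of_le (by positivity) ?_
  linarith [one_add_mul_le_pow (show (-2 : ℝ) ≤ y by linarith) n]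

theorem exp_half_min_le {y : ℝ} (hy : 0 ≤ y) : Real.exp (min y 1 / 2) ≤ 1 + y := by
  set t := min y 1
  have ht0 : 0 ≤ t := le_min hy zero_le_one
  have ht1 : t ≤ 1 := min_le_right _ _
  have hty : t ≤ y := min_le_left _ _
  have h := Real.add_one_le_exp (-(t / 2))
  rw [Real.exp_neg] at h
  have hp := Real.exp_pos (t / 2)
  have h2 : (-(t / 2) + 1) * Real.exp (t / 2) ≤ 1 := by
    calc (-(t / 2) + 1) * Real.exp (t / 2) ≤ (Real.exp (t / 2))⁻¹ * Real.exp (t / 2) := by gcongr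
      _ = 1 := inv_mul_cancel₀ hp.ne'
  nlinarith

/-- Half of the `n` factors `(1 + y)⁻¹` give an exponentially small constant, the other half give
decay in `e`. -/
theorem one_div_one_add_pow_le_exp {n : ℕ} {y δ e p : ℝ} (hn : 2 ≤ n) (hδ : 0 < δ) (he : 0 < e)
    (hy : 0 ≤ y) (h : δ * e ≤ n * y) (hp1 : 6 * p ≤ n) (hp2 : 6 * p ≤ n * y) :
    (1 / (1 + y)) ^ n ≤ Real.exp (-p) * (3 / δ) * e⁻¹ := by
  set k := n / 2 with hk
  have hk2 : k + k ≤ n := by omega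
  have hk3 : (n : ℝ) ≤ 3 * k := by
    have : n ≤ 3 * k := by omega
    exact_mod_cast this
  have h1 : Real.exp p ≤ (1 + y) ^ k := by
    calc Real.exp p ≤ Real.exp (k * (min y 1 / 2)) := by
          refine Real.exp_le_exp.2 ?_
          have hnn : 0 ≤ min y 1 := le_min hy zero_le_one
          have hmin : 6 * p ≤ n * min y 1 := by
            rcases min_choice y 1 with hm | hm <;> rw [hm] <;> linarith
          nlinarith
      _ = Real.exp (min y 1 / 2) ^ k := Real.exp_nat_mul _ _
      _ ≤ _ := by gcongr; exact exp_half_min_le hy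
  have h2 : δ * e / 3 ≤ (1 + y) ^ k := by
    have := one_add_mul_le_pow (show (-2 : ℝ) ≤ y by linarith) k
    nlinarith
  have h3 : Real.exp p * (δ * e / 3) ≤ (1 + y) ^ n := by
    calc Real.exp p * (δ * e / 3) ≤ (1 + y) ^ k * (1 + y) ^ k := by gcongr
      _ = (1 + y) ^ (k + k) := (pow_add _ _ _).symm
      _ ≤ (1 + y) ^ n := by gcongr; linarith
  rw [one_div_pow, Real.exp_neg]
  calc 1 / (1 + y) ^ n ≤ 1 / (Real.exp p * (δ * e / 3)) := by gcongr
    _ = _ := by field_simp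

/-! ### The quadrature error for one entry -/

section Quadrature

theorem hasDerivAt_hyperbola (α μ σ θ : ℝ) :
    HasDerivAt (hyperbola α μ σ) (-(Complex.I * μ * Complex.cos (α + θ * Complex.I))) θ := by
  have h1 : HasDerivAt (fun z : ℂ => μ * (1 - Complex.sin (α + Complex.I * z)) + σ)
      (μ * (-(Complex.cos (α + Complex.I * θ) * (Complex.I * 1)))) (θ : ℂ) :=
    (((((hasDerivAt_id (θ : ℂ)).const_mul Complex.I).const_add (α : ℂ)).csin.const_sub 1).const_mul
      (μ : ℂ)).add_const (σ : ℂ)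
  have h2 := h1.comp_ofReal
  have h3 : (μ * (-(Complex.cos (α + Complex.I * θ) * (Complex.I * 1))) : ℂ)
      = -(Complex.I * μ * Complex.cos (α + θ * Complex.I)) := by
    rw [mul_comm (θ : ℂ)]
    ring
  rwa [h3] at h2

theorem node_eq_arc (α μ σ τ : ℝ) (k : ℤ) :
    node α μ σ τ k = arc μ σ (α + (k * τ : ℂ) * Complex.I) := by
  rw [node, hyperbola_eq_arc]
  push_cast
  rfl

theorem weight_eq_cos (α μ σ τ : ℝ) (k : ℤ) :
    weight α μ σ τ k
      = τ * ((2 * Real.pi : ℂ)⁻¹ * (μ * Complex.cos (α + (k * τ : ℂ) * Complex.I))) := by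
  rw [weight, (hasDerivAt_hyperbola α μ σ (k * τ)).deriv]
  push_cast
  rw [div_eq_mul_inv]
  linear_combination (-(τ : ℂ) * (2 * Real.pi : ℂ)⁻¹ * μ
    * Complex.cos (α + (k * τ : ℂ) * Complex.I)) * Complex.I_sq

theorem arc_re_le {ν : ℝ} (hν : 0 < ν) (ς : ℝ) {w : ℂ} (hw : 0 ≤ Real.sin w.re) :
    (arc ν ς w).re ≤ ν + ς := by
  rw [arc_re]
  have : 0 ≤ ν * (Real.sin w.re * Real.cosh w.im) := by
    have := Real.cosh_pos w.im
    positivity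
  linarith

variable {m : ℕ} {a : Matrix (Fin m) (Fin m) ℝ} {b : Fin m → ℝ}

/-- The points of the spectrum of an element satisfying a sectorial resolvent estimate with vertex
`ς` lie in the half-plane `Re z ≤ ς`. -/
theorem re_le_of_mem_spectrum {R : Type*} [NormedRing R] [NormedAlgebra ℂ R] {Z : R} {ς φ : ℝ}
    (hφ : φ < Real.pi / 2)
    (hsec : ∀ z : ℂ, z ≠ ς → |(z - ς).arg| ≤ Real.pi - φ → z ∈ resolventSet ℂ Z)
    {z : ℂ} (hz : z ∈ spectrum ℂ Z) : z.re ≤ ς := by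
  by_contra! hlt
  have hpos : 0 < (z - ς).re := by simpa using hlt
  refine hz (hsec z (fun h => by simp [h] at hlt) ?_)
  have := Complex.abs_arg_lt_pi_div_two_iff.2 (Or.inl hpos)
  linarith

/-- The contour quadrature error for one entry, in an arbitrary Banach algebra, given bounds for
the powers of the stability function along the hyperbolas. -/
theorem norm_r_pow_mul_q_sub_quadrature_le {R : Type*} [NormedRing R] [NormedAlgebra ℂ R]
    [CompleteSpace R] (hRK : IsAdmissible a b) {Z : R} {M ς φ α d ν ρ Q τ b₀ t₀ : ℝ} {n K : ℕ}
    (hφ0 : 0 ≤ φ) (hφ : φ < Real.pi / 2)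
    (hsec : ∀ z : ℂ, z ≠ ς → |(z - ς).arg| ≤ Real.pi - φ →
      z ∈ resolventSet ℂ Z ∧ ‖resolvent Z z‖ ≤ M / ‖z - ς‖)
    (hd : 0 < d) (hαd : 0 < α - d) (hαd' : α + d < Real.pi / 2 - φ) (hν : 0 < ν)
    (hνς : ν + max ς 0 ≤ ρ) (hQ0 : 0 ≤ Q)
    (hb : ∀ z : ℂ, z.re ≤ ρ → (denom a).eval z ≠ 0 ∧ ∀ i, ‖q a b i z‖ ≤ Q)
    (hn : n ≠ 0) (hτ : 0 < τ) (ht₀ : 0 ≤ t₀)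
    (hr : ∀ w : ℂ, Real.sin (α - d) ≤ Real.sin w.re →
      ‖r a b (arc ν ς w)‖ ^ n ≤ b₀ * Real.exp (-|w.im|))
    (hr' : ∀ w : ℂ, Real.sin (α - d) ≤ Real.sin w.re → K * τ ≤ |w.im| →
      ‖r a b (arc ν ς w)‖ ^ n ≤ t₀ * Real.exp (-|w.im|)) (i : Fin m) :
    ‖r a b Z ^ n * q a b i Z - ∑ k ∈ Finset.Icc (-(K : ℤ)) K,
      (weight α ν ς τ k * r a b (node α ν ς τ k) ^ n * q a b i (node α ν ς τ k)) •
        resolvent Z (node α ν ς τ k)‖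
      ≤ 4 * (M * Real.sqrt (2 / (1 - Real.sin (α + d))) * Q / (2 * Real.pi) * b₀)
          / (Real.exp (2 * Real.pi * d / τ) - 1)
        + M * Real.sqrt (2 / (1 - Real.sin (α + d))) * Q / (2 * Real.pi) * t₀ * (τ + 2) := by
  have hπ := Real.pi_pos
  set Kc := Real.sqrt (2 / (1 - Real.sin (α + d))) with hKc
  have hς : ν + ς ≤ ρ := by linarith [le_max_left ς 0]
  have hρς : ς ≤ ρ := by linarith
  have hs₀ : 0 < Real.sin (α - d) := Real.sin_pos_of_pos_of_lt_pi hαd (by linarith)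
  have hs₁ : Real.sin (α + d) < 1 := by
    rw [← Real.sin_pi_div_two]
    exact Real.sin_lt_sin_of_lt_of_le_pi_div_two (by linarith) le_rfl (by linarith)
  have hsector : ∀ w : ℂ, -(Real.pi / 2) ≤ w.re → w.re ≤ α + d →
      arc ν ς w ∈ resolventSet ℂ Z ∧ ‖resolvent Z (arc ν ς w)‖ ≤ M / ‖arc ν ς w - ς‖ := by
    intro w h1 h2
    obtain ⟨h3, h4⟩ := arc_mem_sector (σ := ς) hν hφ0 hφ h1 (h2.trans_lt hαd')
    exact hsec _ h3 h4
  have hM : 0 ≤ M := by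
    have h1 := (hsector 0 (by simp; positivity) (by simp; linarith)).2
    have h2 : 0 < ‖arc ν ς 0 - ς‖ := by
      rw [norm_arc_sub hν]
      simpa using hν
    have := (norm_nonneg _).trans h1
    rwa [le_div_iff₀ h2, zero_mul] at this
  set F : ℂ → ℂ := fun z => r a b z ^ n * q a b i z with hF
  set g : ℂ → R := fun z => (2 * Real.pi : ℂ)⁻¹ •
    ((ν * Complex.cos (α + z * Complex.I)) • F (arc ν ς (α + z * Complex.I)) •
      resolvent Z (arc ν ς (α + z * Complex.I))) with hg
  -- facts about the points `w = α + z i` of the strip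
  have hwre : ∀ z : ℂ, ((α : ℂ) + z * Complex.I).re = α - z.im := fun z => by simp [sub_eq_add_neg]
  have hwim : ∀ z : ℂ, ((α : ℂ) + z * Complex.I).im = z.re := fun z => by simp
  have hsin : ∀ z : ℂ, |z.im| ≤ d → Real.sin (α - d) ≤ Real.sin ((α : ℂ) + z * Complex.I).re ∧
      Real.sin ((α : ℂ) + z * Complex.I).re ≤ Real.sin (α + d) := by
    intro z hz
    rw [hwre]
    obtain ⟨h1, h2⟩ := abs_le.1 hz
    exact ⟨Real.sin_le_sin_of_le_of_le_pi_div_two (by linarith) (by linarith) (by linarith),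
      Real.sin_le_sin_of_le_of_le_pi_div_two (by linarith) (by linarith) (by linarith)⟩
  have hres : ∀ z : ℂ, |z.im| ≤ d → arc ν ς (α + z * Complex.I) ∈ resolventSet ℂ Z ∧
      ‖resolvent Z (arc ν ς (α + z * Complex.I))‖ ≤ M / ‖arc ν ς (α + z * Complex.I) - ς‖ := by
    intro z hz
    obtain ⟨h1, h2⟩ := abs_le.1 hz
    exact hsector _ (by rw [hwre]; linarith) (by rw [hwre]; linarith)
  have hre : ∀ z : ℂ, |z.im| ≤ d → (arc ν ς (α + z * Complex.I)).re ≤ ρ := fun z hz =>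
    (arc_re_le hν ς (hs₀.le.trans (hsin z hz).1)).trans hς
  have hFd : ∀ z : ℂ, z.re ≤ ρ → DifferentiableAt ℂ F z := fun z hz =>
    ((differentiableAt_r b (hb z hz).1).pow n).mul (differentiableAt_q b (hb z hz).1 i)
  have hgd : DifferentiableOn ℂ g {z | |z.im| ≤ d} := by
    intro z hz
    have harc : DifferentiableAt ℂ (fun z : ℂ => arc ν ς (α + z * Complex.I)) z :=
      (differentiable_arc ν ς _).comp z (by fun_prop)
    have h1 : DifferentiableAt ℂ (fun z : ℂ => F (arc ν ς (α + z * Complex.I))) z :=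
      DifferentiableAt.comp (g := F) z (hFd _ (hre z hz)) harc
    have h2 : DifferentiableAt ℂ (fun z : ℂ => resolvent Z (arc ν ς (α + z * Complex.I))) z :=
      DifferentiableAt.comp (g := resolvent Z) z
        (spectrum.hasDerivAt_resolvent_const_left (hres z hz).1).differentiableAt harc
    have h3 : DifferentiableAt ℂ (fun z : ℂ => ν * Complex.cos (α + z * Complex.I)) z := by fun_prop
    exact ((h3.smul (h1.smul h2)).const_smul (2 * Real.pi : ℂ)⁻¹).differentiableWithinAt
  have hgb : ∀ z : ℂ, |z.im| ≤ d → ‖g z‖ ≤ M * Kc * Q / (2 * Real.pi)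
      * ‖r a b (arc ν ς (α + z * Complex.I))‖ ^ n := by
    intro z hz
    set w : ℂ := α + z * Complex.I with hw
    have hpos : 0 < ‖1 - Complex.sin w‖ := by
      rw [norm_one_sub_sin]
      linarith [Real.one_le_cosh w.im, (hsin z hz).2]
    have h1 : ‖(ν * Complex.cos w : ℂ)‖ ≤ ν * (Kc * ‖1 - Complex.sin w‖) := by
      rw [norm_mul, Complex.norm_real, Real.norm_of_nonneg hν.le]
      gcongr
      exact norm_cos_le_mul_norm_one_sub_sin hs₁ (hsin z hz).2
    have h2 : ‖resolvent Z (arc ν ς w)‖ ≤ M / (ν * ‖1 - Complex.sin w‖) := by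
      have := (hres z hz).2
      rwa [arc_sub, norm_mul, Complex.norm_real, Real.norm_of_nonneg hν.le] at this
    have h3 : ‖F (arc ν ς w)‖ ≤ ‖r a b (arc ν ς w)‖ ^ n * Q := by
      rw [hF, norm_mul, norm_pow]
      gcongr
      exact (hb _ (hre z hz)).2 i
    have h4 : ‖(2 * Real.pi : ℂ)⁻¹‖ = (2 * Real.pi)⁻¹ := by
      rw [norm_inv, norm_mul, Complex.norm_real, Real.norm_of_nonneg hπ.le, Complex.norm_ofNat]
    rw [hg]
    simp only [norm_smul]
    rw [h4]
    calc (2 * Real.pi)⁻¹ * (‖(ν * Complex.cos w : ℂ)‖ * (‖F (arc ν ς w)‖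
          * ‖resolvent Z (arc ν ς w)‖))
        ≤ (2 * Real.pi)⁻¹ * ((ν * (Kc * ‖1 - Complex.sin w‖)) * ((‖r a b (arc ν ς w)‖ ^ n * Q)
          * (M / (ν * ‖1 - Complex.sin w‖)))) := by gcongr
      _ = _ := by field_simp
  have hC : 0 ≤ M * Kc * Q / (2 * Real.pi) := by positivity
  -- the integral over the hyperbola
  have hunit : IsUnit (Polynomial.aeval Z (denom a)) :=
    isUnit_aeval_of_eval_ne_zero (denom_ne_zero a) fun z hz =>
      (hb z ((re_le_of_mem_spectrum hφ (fun z h h' => (hsec z h h').1) hz).trans hρς)).1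
  have hunit' : IsUnit (Polynomial.aeval Z (denom a ^ (n + 1))) := by
    rw [map_pow]
    exact hunit.pow _
  have hF0 : Tendsto F (Bornology.cobounded ℂ ⊓ 𝓟 {z | z.re ≤ ρ}) (𝓝 0) := by
    have h1 := hRK.r_infty
    rw [← Metric.cobounded_eq_cocompact] at h1
    have h2 := (((h1.norm.pow n).mul_const Q).mono_left
      (inf_le_left (b := 𝓟 {z : ℂ | z.re ≤ ρ})))
    rw [norm_zero, zero_pow hn, zero_mul] at h2
    refine squeeze_zero_norm' ?_ h2
    rw [eventually_inf_principal]
    refine Eventually.of_forall fun z hz => ?_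
    rw [hF, norm_mul, norm_pow]
    gcongr
    exact (hb z hz).2 i
  have hint := tendsto_integral_hyperbola (Z := Z) (F := F)
    (FZ := Polynomial.aeval Z (rNum a b ^ n * qNum a b i)
      * Ring.inverse (Polynomial.aeval Z (denom a ^ (n + 1))))
    (S := regularPart (rNum a b ^ n * qNum a b i) (denom a ^ (n + 1)) Z) (ρ := ρ) (α := α)
    (σ := ς) hν (by linarith) (by linarith)
    (fun w h1 h2 => (hsector w h1 (by linarith)).1)
    (fun w h1 h2 => (arc_re_le hν ς (Real.sin_nonneg_of_nonneg_of_le_pi (by linarith)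
      (by linarith))).trans hς)
    (fun z hz => differentiableAt_regularPart _ _ _ (by
      rw [Polynomial.eval_pow]
      exact pow_ne_zero _ (hb z hz).1))
    hF0
    (fun z hz hzρ => by
      rw [hF]
      simp only
      rw [r_pow_mul_q_eq_div b (hb z hzρ).1]
      refine smul_resolvent_eq_add_regularPart hunit' ?_ hz
      rw [Polynomial.eval_pow]
      exact pow_ne_zero _ (hb z hzρ).1)
  rw [← r_pow_mul_q_eq_aeval b hunit] at hint
  have hv : Tendsto (fun T : ℝ => ∫ x in (-T)..T, g x) atTop (𝓝 (r a b Z ^ n * q a b i Z)) := by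
    have h := hint.const_smul (2 * Real.pi : ℂ)⁻¹
    have h0 : (2 * Real.pi : ℂ)⁻¹ • (2 * Real.pi) • (r a b Z ^ n * q a b i Z)
        = r a b Z ^ n * q a b i Z := by
      rw [← Complex.coe_smul, smul_smul]
      push_cast
      rw [inv_mul_cancel₀ (by simp [hπ.ne']), one_smul]
    rw [h0] at h
    refine h.congr fun T => ?_
    rw [hg, intervalIntegral.integral_smul]
  have hfinal := norm_sub_truncated_trapezoid_le (K := K)
    (b := M * Kc * Q / (2 * Real.pi) * b₀) (t := M * Kc * Q / (2 * Real.pi) * t₀) hτ hd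
    (by positivity) hgd
    (fun z hz => by
      refine (hgb z hz).trans ?_
      have := hr _ (hsin z hz).1
      rw [hwim] at this
      rw [mul_assoc (_ / _)]
      gcongr) hv
    (fun x hx => by
      have hx0 : |((x : ℂ)).im| ≤ d := by simpa using hd.le
      refine (hgb x hx0).trans ?_
      have := hr' _ (hsin x hx0).1 (by rw [hwim]; simpa using hx)
      rw [hwim, Complex.ofReal_re] at this
      rw [mul_assoc (_ / _)]
      gcongr)
  have hsum : ∑ k ∈ Finset.Icc (-(K : ℤ)) K,
      (weight α ν ς τ k * r a b (node α ν ς τ k) ^ n * q a b i (node α ν ς τ k)) •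
        resolvent Z (node α ν ς τ k) = ∑ k ∈ Finset.Icc (-(K : ℤ)) K, (τ : ℂ) • g (k * τ) := by
    refine Finset.sum_congr rfl fun k _ => ?_
    rw [weight_eq_cos, node_eq_arc, hg, hF]
    simp only [smul_smul]
    congr 1
    ring
  rw [hsum]
  exact hfinal

/-! ### Scaling by the step size -/

section Scaling

variable {E : Type*} [NormedAddCommGroup E] [NormedSpace ℂ E]

theorem resolvent_smul {A : E →L[ℂ] E} {h : ℝ} (hh : 0 < h) (z : ℂ) :
    resolvent (-((h : ℂ) • A)) ((h : ℂ) * z) = (h : ℂ)⁻¹ • resolvent (-A) z := by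
  have hne : (h : ℂ) ≠ 0 := by exact_mod_cast hh.ne'
  have := spectrum.units_smul_resolvent (r := (Units.mk0 (h : ℂ) hne)⁻¹) (s := z) (a := -A)
  rw [inv_inv, Units.smul_def, Units.smul_def, Units.smul_def] at this
  simp only [Units.val_inv_eq_inv_val, Units.val_mk0, smul_eq_mul, smul_neg] at this
  exact this.symm

theorem mem_resolventSet_smul {A : E →L[ℂ] E} {h : ℝ} (hh : 0 < h) {z : ℂ}
    (hz : z ∈ resolventSet ℂ (-A)) : (h : ℂ) * z ∈ resolventSet ℂ (-((h : ℂ) • A)) := by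
  have hne : (h : ℂ) ≠ 0 := by exact_mod_cast hh.ne'
  rw [spectrum.isUnit_resolvent] at hz ⊢
  rw [resolvent_smul hh]
  exact hz.smul (Units.mk0 (h : ℂ) hne)⁻¹

theorem IsSectorial.smul {A : E →L[ℂ] E} {M σ φ h : ℝ} (hA : IsSectorial A M σ φ) (hh : 0 < h) :
    IsSectorial ((h : ℂ) • A) M (h * σ) φ := by
  intro z hz harg
  have hne : (h : ℂ) ≠ 0 := by exact_mod_cast hh.ne'
  obtain ⟨w, rfl⟩ : ∃ w, z = h * w := ⟨(h : ℂ)⁻¹ * z, by field_simp⟩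
  have hsub : (h : ℂ) * w - ((h * σ : ℝ) : ℂ) = (h : ℂ) * (w - σ) := by push_cast; ring
  rw [hsub, Complex.arg_real_mul _ hh] at harg
  obtain ⟨h1, h2⟩ := hA w (fun h' => hz (by rw [h']; push_cast; rfl)) harg
  refine ⟨mem_resolventSet_smul hh h1, ?_⟩
  rw [resolvent_smul hh, hsub, norm_smul, norm_mul, norm_inv, Complex.norm_real,
    Real.norm_of_nonneg hh.le]
  calc h⁻¹ * ‖resolvent (-A) w‖ ≤ h⁻¹ * (M / ‖w - σ‖) := by gcongr
    _ = _ := by rw [div_mul_eq_div_div, div_right_comm, inv_mul_eq_div]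

theorem hyperbola_scale (α μ σ h θ : ℝ) :
    hyperbola α (h * μ) (h * σ) θ = h * hyperbola α μ σ θ := by
  rw [hyperbola, hyperbola]
  push_cast
  ring

theorem node_scale (α μ σ τ h : ℝ) (k : ℤ) :
    node α (h * μ) (h * σ) τ k = h * node α μ σ τ k := hyperbola_scale _ _ _ _ _

theorem weight_scale (α μ σ τ h : ℝ) (k : ℤ) :
    weight α (h * μ) (h * σ) τ k = h * weight α μ σ τ k := by
  rw [weight_eq_cos, weight_eq_cos]
  push_cast
  ring

theorem quadrature_eq_scaled (A : E →L[ℂ] E) (α μ σ τ : ℝ) {h : ℝ} (hh : 0 < h) (K n : ℕ)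
    (i : Fin m) : quadrature a b A α μ σ τ h K n i = ∑ k ∈ Finset.Icc (-(K : ℤ)) K,
      (weight α (h * μ) (h * σ) τ k * r a b (node α (h * μ) (h * σ) τ k) ^ n
        * q a b i (node α (h * μ) (h * σ) τ k)) •
        resolvent (-((h : ℂ) • A)) (node α (h * μ) (h * σ) τ k) := by
  have hne : (h : ℂ) ≠ 0 := by exact_mod_cast hh.ne'
  rw [quadrature]
  refine Finset.sum_congr rfl fun k _ => ?_
  rw [weight_scale, node_scale, resolvent_smul hh, smul_smul]
  congr 1
  field_simp

end Scaling

end Quadrature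

/-! ### Uniform error bound -/

theorem IsSectorial.abs_const {E : Type*} [NormedAddCommGroup E] [NormedSpace ℂ E]
    {A : E →L[ℂ] E} {M σ φ : ℝ} (hA : IsSectorial A M σ φ) : IsSectorial A |M| σ φ :=
  fun z hz harg => ⟨(hA z hz harg).1, (hA z hz harg).2.trans (by gcongr; exact le_abs_self M)⟩

/-- A large exponent `J` of the discretization error absorbs the growth `exp (P ℓ)` of the integrand
and all constants, where `ℓ = log (1/ε)`. -/
theorem discretization_constant_le {D P J ℓ k : ℝ} {N : ℕ} (hP : 0 ≤ P) (hk : 0 < k)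
    (hℓ : Real.log 2 ≤ ℓ) (hN : 1 + 2 * k * D ≤ 2 ^ N) (hJ : J = (P + 1 + N) * ℓ) :
    D * Real.exp (P * ℓ) / (Real.exp J - 1) ≤ Real.exp (-ℓ) / (2 * k) := by
  have hℓ0 : 0 < ℓ := (Real.log_pos one_lt_two).trans_le hℓ
  have h2 : (2 : ℝ) ^ N ≤ Real.exp (N * ℓ) := by
    rw [Real.exp_nat_mul]
    gcongr
    rw [← Real.log_le_iff_le_exp two_pos]
    exact hℓ
  have hE : Real.exp J = Real.exp (P * ℓ) * Real.exp ℓ * Real.exp (N * ℓ) := by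
    rw [hJ, ← Real.exp_add, ← Real.exp_add]
    ring_nf
  have hp1 : 1 ≤ Real.exp (P * ℓ) := Real.one_le_exp (by positivity)
  have hp2 : 1 ≤ Real.exp ℓ := Real.one_le_exp hℓ0.le
  have h3 : 1 + Real.exp (P * ℓ) * Real.exp ℓ * (2 * k * D) ≤ Real.exp J := by
    rw [hE]
    have h4 : (1 : ℝ) ≤ Real.exp (P * ℓ) * Real.exp ℓ := one_le_mul_of_one_le_of_one_le hp1 hp2
    calc 1 + Real.exp (P * ℓ) * Real.exp ℓ * (2 * k * D)
        ≤ Real.exp (P * ℓ) * Real.exp ℓ * (1 + 2 * k * D) := by linarith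
      _ ≤ _ := by gcongr; linarith
  have hpos : 0 < Real.exp J - 1 := by
    have : 0 < J := by
      rw [hJ]
      positivity
    have := Real.add_one_lt_exp this.ne'
    linarith
  rw [div_le_div_iff₀ hpos (by positivity), Real.exp_neg]
  have h5 : Real.exp (P * ℓ) * Real.exp ℓ * (2 * k * D) ≤ Real.exp J - 1 := by linarith
  calc D * Real.exp (P * ℓ) * (2 * k)
      = (Real.exp ℓ)⁻¹ * (Real.exp (P * ℓ) * Real.exp ℓ * (2 * k * D)) := by
        field_simp
    _ ≤ _ := by gcongr

/-- The error bound under the hypothesis `σ ≤ Λ μ`, with `h₀` and `c` independent of `Λ`. The cases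
of a bounded time interval and of `σ ≤ 0` are instances. -/
theorem exists_quadratureError_le {m : ℕ} (a : Matrix (Fin m) (Fin m) ℝ) (b : Fin m → ℝ)
    (hRK : IsAdmissible a b) (B : ℕ) (hB : 1 < B) (M σ φ α c₁ : ℝ) (hφ₀ : 0 ≤ φ)
    (hφ : φ < Real.pi / 2) (hα₀ : 0 < α) (hα : α < Real.pi / 2 - φ) (hc₁ : 0 < c₁) :
    ∃ h₀ > (0 : ℝ), ∃ c > (0 : ℝ), ∀ Λ ≥ (0 : ℝ), ∃ C > (0 : ℝ), ∃ s > (0 : ℝ),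
      ∀ ε : ℝ, 0 < ε → ε ≤ 1 / 2 → ∃ K : ℕ, (K : ℝ) ≤ C * Real.log (1 / ε) ∧
        ∀ (E : Type u) [NormedAddCommGroup E] [NormedSpace ℂ E] [CompleteSpace E]
          (A : E →L[ℂ] E), IsSectorial A M σ φ →
        ∀ h : ℝ, 0 < h → h ≤ h₀ → ∀ l : ℕ, 1 ≤ l →
        ∀ n : ℕ, (n : ℝ) * h ∈ timeInterval B h l → c * Real.log (1 / ε) ≤ n →
          σ ≤ Λ * (c₁ * Real.log (1 / ε) / ((B : ℝ) ^ l * h)) →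
          quadratureError a b A α (c₁ * Real.log (1 / ε) / ((B : ℝ) ^ l * h)) σ
            (s / Real.log (1 / ε)) h K n ≤ ε := by
  have hπ := Real.pi_pos
  have hlog2 : 0 < Real.log 2 := Real.log_pos one_lt_two
  have hB0 : (0 : ℝ) < B := by exact_mod_cast zero_lt_one.trans hB
  -- the half-width of the strip of analyticity
  set d := min (α / 2) ((Real.pi / 2 - φ - α) / 2) with hd
  have hd0 : 0 < d := lt_min (by linarith) (by linarith)
  have hd1 : d ≤ α / 2 := min_le_left _ _
  have hd2 : d ≤ (Real.pi / 2 - φ - α) / 2 := min_le_right _ _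
  have hs₀ : 0 < Real.sin (α - d) := Real.sin_pos_of_pos_of_lt_pi (by linarith) (by linarith)
  obtain ⟨ρ, hρ, L, hL, Q, hQ, u, hu, hDQ, harc⟩ := exists_bounds_on_arc hRK hs₀
  set θ := c₁ / B with hθ
  have hθ0 : 0 < θ := by positivity
  set δ := u * θ * Real.log 2 with hδ
  have hδ0 : 0 < δ := by positivity
  set G := |M| * Real.sqrt (2 / (1 - Real.sin (α + d))) * Q / (2 * Real.pi) with hG
  have hG0 : 0 ≤ G := by positivity
  set Ct := G * (3 / δ) * (2 * Real.pi * d / Real.log 2 + 2) with hCt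
  have hCt0 : 0 ≤ Ct := by positivity
  obtain ⟨p, hp⟩ := pow_unbounded_of_one_lt (2 * (m + 1 : ℝ) * Ct) one_lt_two
  refine ⟨ρ / (2 * (|σ| + 1)), by positivity, 6 * (p + 1) + 4 / Real.log 2 + 2 * c₁ / ρ,
    by positivity, fun Λ hΛ => ?_⟩
  obtain ⟨X, hX, hr⟩ := harc Λ hΛ
  set P := L * (1 + Λ) * c₁ with hP
  have hP0 : 0 ≤ P := by positivity
  set D := 4 * (G * (Real.exp X * (1 + 1 / δ))) with hDdef
  have hD0 : 0 ≤ D := by positivity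
  obtain ⟨N, hN⟩ := pow_unbounded_of_one_lt (1 + 2 * (m + 1 : ℝ) * D) one_lt_two
  set s := 2 * Real.pi * d / (P + 1 + N) with hs
  have hs0 : 0 < s := by positivity
  set X' := max X (Real.log (6 * (p + 1) / (u * θ))) with hX'
  have hX'0 : 0 ≤ X' := hX.trans (le_max_left _ _)
  have hX'exp : 6 * (p + 1) ≤ u * θ * Real.exp X' := by
    have h1 : 6 * (p + 1) / (u * θ) ≤ Real.exp X' := by
      rw [← Real.exp_log (show (0 : ℝ) < 6 * (p + 1) / (u * θ) by positivity)]
      exact Real.exp_le_exp.2 (le_max_right _ _)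
    rwa [div_le_iff₀' (by positivity)] at h1
  refine ⟨X' / s + 1 / Real.log 2, by positivity, s, hs0, fun ε hε hε2 => ?_⟩
  set ℓ := Real.log (1 / ε) with hℓ
  have hℓ2 : Real.log 2 ≤ ℓ := by
    refine Real.log_le_log two_pos ?_
    rw [le_div_iff₀ hε]
    linarith
  have hℓ0 : 0 < ℓ := hlog2.trans_le hℓ2
  have hεℓ : Real.exp (-ℓ) = ε := by
    rw [hℓ, one_div, Real.log_inv, neg_neg, Real.exp_log hε]
  set τ := s / ℓ with hτ
  have hτ0 : 0 < τ := by positivity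
  refine ⟨⌈X' / τ⌉₊, ?_, ?_⟩
  · refine (Nat.ceil_lt_add_one (by positivity)).le.trans ?_
    have h1 : 1 ≤ 1 / Real.log 2 * ℓ := by
      rw [one_div, inv_mul_eq_div, le_div_iff₀ hlog2]
      linarith
    have h2 : X' / τ = X' / s * ℓ := by
      rw [hτ]
      field_simp
    rw [h2, add_mul]
    linarith
  intro E _ _ _ A hA h hh hh₀ l hl n hmem hcn hσΛ
  set K := ⌈X' / τ⌉₊ with hK
  set μ := c₁ * ℓ / ((B : ℝ) ^ l * h) with hμ
  -- the scaled parameters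
  set ν := h * μ with hν
  have hBl : (0 : ℝ) < (B : ℝ) ^ l := by positivity
  have hν' : ν = c₁ * ℓ / (B : ℝ) ^ l := by
    rw [hν, hμ]
    field_simp
  have hν0 : 0 < ν := by rw [hν']; positivity
  have hnB1 : (B : ℝ) ^ l ≤ B * n := by
    have h1 : (B : ℝ) ^ (l - 1) ≤ n := le_of_mul_le_mul_right hmem.1 hh
    calc (B : ℝ) ^ l = B * (B : ℝ) ^ (l - 1) := by
          rw [← pow_succ', Nat.sub_add_cancel hl]
      _ ≤ _ := by gcongr
  have hnB2 : (n : ℝ) < (B : ℝ) ^ l := lt_of_mul_lt_mul_right hmem.2 hh.le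
  have hc6 : 6 * ((p + 1) * ℓ) ≤ n := by
    refine le_trans ?_ hcn
    have : 0 ≤ (4 / Real.log 2 + 2 * c₁ / ρ) * ℓ := by positivity
    linarith
  have hn4 : (4 : ℝ) ≤ n := by
    refine le_trans ?_ hcn
    have h1 : 4 / Real.log 2 * Real.log 2 = 4 := by field_simp
    have h2 : 4 / Real.log 2 * Real.log 2 ≤ 4 / Real.log 2 * ℓ := by gcongr
    have : 0 ≤ (6 * (p + 1) + 2 * c₁ / ρ) * ℓ := by positivity
    linarith
  have hn2 : 2 ≤ n := by
    have : 4 ≤ n := by exact_mod_cast hn4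
    omega
  have hnpos : (0 : ℝ) < n := by linarith
  have hνρ : ν ≤ ρ / 2 := by
    have h1 : 2 * c₁ / ρ * ℓ ≤ n := by
      refine le_trans ?_ hcn
      have : 0 ≤ (6 * (p + 1) + 4 / Real.log 2) * ℓ := by positivity
      linarith
    rw [hν', div_le_iff₀ hBl]
    have h2 : c₁ * ℓ = ρ / 2 * (2 * c₁ / ρ * ℓ) := by field_simp
    rw [h2]
    have h3 : 2 * c₁ / ρ * ℓ ≤ (B : ℝ) ^ l := h1.trans hnB2.le
    gcongr
  have hnν1 : θ * ℓ ≤ n * ν := by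
    rw [hν', hθ, mul_div_assoc', div_mul_eq_mul_div, div_le_div_iff₀ hB0 hBl]
    have := mul_le_mul_of_nonneg_left hnB1 (show 0 ≤ c₁ * ℓ by positivity)
    linarith
  have hnν2 : n * ν ≤ c₁ * ℓ := by
    rw [hν', mul_div_assoc', div_le_iff₀ hBl]
    have := mul_le_mul_of_nonneg_left hnB2.le (show 0 ≤ c₁ * ℓ by positivity)
    linarith
  have hςΛ : h * σ ≤ Λ * ν := by
    have := mul_le_mul_of_nonneg_left hσΛ hh.le
    rw [hν]
    linarith
  have hνς : ν + max (h * σ) 0 ≤ ρ := by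
    have h1 : h * (|σ| + 1) ≤ ρ / 2 := by
      have h2 := mul_le_mul_of_nonneg_right hh₀ (show 0 ≤ |σ| + 1 by positivity)
      have h3 : ρ / (2 * (|σ| + 1)) * (|σ| + 1) = ρ / 2 := by field_simp
      linarith
    have h4 : h * σ ≤ h * (|σ| + 1) := by
      gcongr
      linarith [le_abs_self σ]
    have : max (h * σ) 0 ≤ ρ / 2 := max_le (h4.trans h1) (by positivity)
    linarith
  -- the two bounds for the powers of the stability function
  set b₀ := Real.exp (P * ℓ) * (Real.exp X * (1 + 1 / δ)) with hb₀
  set t₀ := Real.exp (-((p + 1) * ℓ)) * (3 / δ) with ht₀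
  have hdecay : ∀ w : ℂ, Real.sin (α - d) ≤ Real.sin w.re → X ≤ |w.im| →
      ‖r a b (arc ν (h * σ) w)‖ ^ n ≤ (1 / (1 + u * ν * Real.exp |w.im|)) ^ n := fun w hw hX =>
    pow_le_pow_left₀ (norm_nonneg _) ((hr ν (h * σ) hν0 hςΛ hνς w hw).2.2 hX) n
  have hδn : ∀ w : ℂ, δ * Real.exp |w.im| ≤ n * (u * ν * Real.exp |w.im|) := by
    intro w
    have h1 : u * (θ * Real.log 2) ≤ u * (n * ν) := mul_le_mul_of_nonneg_left
      ((mul_le_mul_of_nonneg_left hℓ2 hθ0.le).trans hnν1) hu.le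
    calc δ * Real.exp |w.im| = u * (θ * Real.log 2) * Real.exp |w.im| := by rw [hδ]; ring
      _ ≤ u * (n * ν) * Real.exp |w.im| := by gcongr
      _ = _ := by ring
  have hr₁ : ∀ w : ℂ, Real.sin (α - d) ≤ Real.sin w.re →
      ‖r a b (arc ν (h * σ) w)‖ ^ n ≤ b₀ * Real.exp (-|w.im|) := by
    intro w hw
    have hP1 : 1 ≤ Real.exp (P * ℓ) := Real.one_le_exp (by positivity)
    have hX1 : 1 ≤ Real.exp X := Real.one_le_exp hX
    have hδ1 : 0 < 1 / δ := by positivity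
    rcases le_or_gt X |w.im| with hw' | hw'
    · refine (hdecay w hw hw').trans ((one_div_one_add_pow_le hδ0 (Real.exp_pos _) (by positivity)
        (hδn w)).trans ?_)
      rw [← Real.exp_neg]
      refine mul_le_mul_of_nonneg_right ?_ (Real.exp_pos _).le
      calc 1 / δ ≤ 1 * (1 * (1 + 1 / δ)) := by linarith
        _ ≤ b₀ := by rw [hb₀]; gcongr
    · have h1 : ‖r a b (arc ν (h * σ) w)‖ ^ n ≤ Real.exp (P * ℓ) := by
        refine (pow_le_pow_left₀ (norm_nonneg _) (hr ν (h * σ) hν0 hςΛ hνς w hw).2.1 n).trans ?_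
        rw [← Real.exp_nat_mul, Real.exp_le_exp]
        calc n * (L * (ν * (1 + Λ))) = L * (1 + Λ) * (n * ν) := by ring
          _ ≤ L * (1 + Λ) * (c₁ * ℓ) := by gcongr
          _ = P * ℓ := by rw [hP]; ring
      have h2 : 1 ≤ Real.exp X * (1 + 1 / δ) * Real.exp (-|w.im|) := by
        have h3 : 1 ≤ Real.exp X * Real.exp (-|w.im|) := by
          rw [← Real.exp_add]
          exact Real.one_le_exp (by linarith)
        calc (1 : ℝ) ≤ (Real.exp X * Real.exp (-|w.im|)) * (1 + 1 / δ) :=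
              one_le_mul_of_one_le_of_one_le h3 (by linarith)
          _ = _ := by ring
      rw [hb₀, mul_assoc]
      exact h1.trans (le_mul_of_one_le_right (Real.exp_pos _).le h2)
  have hr₂ : ∀ w : ℂ, Real.sin (α - d) ≤ Real.sin w.re → K * τ ≤ |w.im| →
      ‖r a b (arc ν (h * σ) w)‖ ^ n ≤ t₀ * Real.exp (-|w.im|) := by
    intro w hw hKw
    have hXw : X' ≤ |w.im| := by
      refine le_trans ?_ hKw
      rw [← div_le_iff₀ hτ0]
      exact Nat.le_ceil _
    refine (hdecay w hw ((le_max_left _ _).trans hXw)).trans ?_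
    rw [ht₀, Real.exp_neg |w.im|]
    refine one_div_one_add_pow_le_exp hn2 hδ0 (Real.exp_pos _) (by positivity) (hδn w) hc6 ?_
    calc 6 * ((p + 1) * ℓ) = 6 * (p + 1) * ℓ := by ring
      _ ≤ u * θ * Real.exp X' * ℓ := by gcongr
      _ ≤ u * θ * Real.exp |w.im| * ℓ := by gcongr
      _ = u * Real.exp |w.im| * (θ * ℓ) := by ring
      _ ≤ u * Real.exp |w.im| * (n * ν) := by gcongr
      _ = _ := by ring
  -- each entry contributes at most `ε / (m + 1)`
  have hterm₁ : 4 * (G * b₀) / (Real.exp (2 * Real.pi * d / τ) - 1) ≤ ε / (2 * (m + 1 : ℝ)) := by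
    have hJ : 2 * Real.pi * d / τ = (P + 1 + N) * ℓ := by
      rw [hτ, hs]
      field_simp
    have := discretization_constant_le (k := (m + 1 : ℝ)) hP0 (by positivity) hℓ2 hN.le hJ
    rw [hεℓ] at this
    refine le_trans (le_of_eq ?_) this
    rw [hDdef, hb₀]
    ring
  have hterm₂ : G * t₀ * (τ + 2) ≤ ε / (2 * (m + 1 : ℝ)) := by
    have h1 : Real.exp (-((p + 1) * ℓ)) = Real.exp (-(p * ℓ)) * ε := by
      rw [← hεℓ, ← Real.exp_add]
      ring_nf
    have h2 : (2 : ℝ) ^ p ≤ Real.exp (p * ℓ) := by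
      rw [Real.exp_nat_mul]
      gcongr
      rw [← Real.log_le_iff_le_exp two_pos]
      exact hℓ2
    have h3 : τ ≤ 2 * Real.pi * d / Real.log 2 := by
      have : s ≤ 2 * Real.pi * d := div_le_self (by positivity) (by
        have : (0 : ℝ) ≤ N := N.cast_nonneg
        linarith)
      rw [hτ]
      gcongr
    have h4 : G * (3 / δ) * (τ + 2) ≤ Ct := by
      rw [hCt]
      gcongr
    have h5 : Ct * Real.exp (-(p * ℓ)) ≤ 1 / (2 * (m + 1 : ℝ)) := by
      rw [Real.exp_neg, ← div_eq_mul_inv, div_le_div_iff₀ (Real.exp_pos _) (by positivity)]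
      linarith
    calc G * t₀ * (τ + 2) = G * (3 / δ) * (τ + 2) * Real.exp (-(p * ℓ)) * ε := by
          rw [ht₀, h1]
          ring
      _ ≤ Ct * Real.exp (-(p * ℓ)) * ε := by gcongr
      _ ≤ 1 / (2 * (m + 1 : ℝ)) * ε := by gcongr
      _ = _ := by ring
  have hentry : ∀ i, ‖r a b (-((h : ℂ) • A)) ^ n * q a b i (-((h : ℂ) • A))
      - quadrature a b A α μ σ τ h K n i‖ ≤ ε / (m + 1) := by
    intro i
    rw [quadrature_eq_scaled A α μ σ τ hh K n i]
    refine (norm_r_pow_mul_q_sub_quadrature_le hRK hφ₀ hφ (hA.abs_const.smul hh) hd0 (by linarith)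
      (by linarith) hν0 hνς hQ.le hDQ (by omega) hτ0 (by positivity) hr₁ hr₂
      i).trans ?_
    have h1 : ε / (m + 1 : ℝ) = ε / (2 * (m + 1 : ℝ)) + ε / (2 * (m + 1 : ℝ)) := by
      field_simp
      norm_num
    rw [h1]
    exact add_le_add hterm₁ hterm₂
  calc quadratureError a b A α μ σ τ h K n ≤ ∑ _i : Fin m, ε / (m + 1 : ℝ) :=
        Finset.sum_le_sum fun i _ => hentry i
    _ = m * (ε / (m + 1)) := by simp
    _ ≤ ε := by
        rw [mul_div_assoc', div_le_iff₀ (by positivity)]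
        linarith

end RungeKuttaContour

theorem theorem1 {m : ℕ} (a : Matrix (Fin m) (Fin m) ℝ) (b : Fin m → ℝ)
    (hRK : RungeKuttaContour.IsAdmissible a b)
    (B : ℕ) (hB : 1 < B) (M σ φ α c₁ : ℝ) (hφ₀ : 0 ≤ φ) (hφ : φ < Real.pi / 2)
    (hα₀ : 0 < α) (hα : α < Real.pi / 2 - φ) (hc₁ : 0 < c₁) :
    ∃ h₀ > (0 : ℝ), ∃ c > (0 : ℝ),
      (∀ T > (0 : ℝ), ∃ C > (0 : ℝ), ∃ s > (0 : ℝ), ∀ ε : ℝ, 0 < ε → ε ≤ 1 / 2 →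
        ∃ K : ℕ, (K : ℝ) ≤ C * Real.log (1 / ε) ∧
          ∀ (E : Type u) [NormedAddCommGroup E] [NormedSpace ℂ E] [CompleteSpace E]
            (A : E →L[ℂ] E), RungeKuttaContour.IsSectorial A M σ φ →
          ∀ h : ℝ, 0 < h → h ≤ h₀ → ∀ l : ℕ, 1 ≤ l →
          ∀ n : ℕ, (n : ℝ) * h ∈ RungeKuttaContour.timeInterval B h l →
            c * Real.log (1 / ε) ≤ n → (n : ℝ) * h ≤ T →
            RungeKuttaContour.quadratureError a b A α
              (c₁ * Real.log (1 / ε) / ((B : ℝ) ^ l * h)) σ (s / Real.log (1 / ε)) h K n ≤ ε) ∧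
      (σ ≤ 0 → ∃ C > (0 : ℝ), ∃ s > (0 : ℝ), ∀ ε : ℝ, 0 < ε → ε ≤ 1 / 2 →
        ∃ K : ℕ, (K : ℝ) ≤ C * Real.log (1 / ε) ∧
          ∀ (E : Type u) [NormedAddCommGroup E] [NormedSpace ℂ E] [CompleteSpace E]
            (A : E →L[ℂ] E), RungeKuttaContour.IsSectorial A M σ φ →
          ∀ h : ℝ, 0 < h → h ≤ h₀ → ∀ l : ℕ, 1 ≤ l →
          ∀ n : ℕ, (n : ℝ) * h ∈ RungeKuttaContour.timeInterval B h l →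
            c * Real.log (1 / ε) ≤ n →
            RungeKuttaContour.quadratureError a b A α
              (c₁ * Real.log (1 / ε) / ((B : ℝ) ^ l * h)) σ (s / Real.log (1 / ε)) h K n ≤ ε) := by
  obtain ⟨h₀, hh₀, c, hc, H⟩ := RungeKuttaContour.exists_quadratureError_le.{u} a b hRK B hB M σ φ α
    c₁ hφ₀ hφ hα₀ hα hc₁
  have hB0 : (0 : ℝ) < B := by exact_mod_cast zero_lt_one.trans hB
  have hlog2 : 0 < Real.log 2 := Real.log_pos one_lt_two
  refine ⟨h₀, hh₀, c, hc, fun T hT => ?_, fun hσ => ?_⟩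
  · -- `μ ≥ c₁ log 2 / (B T)` on the time interval, since `B ^ l h ≤ B n h ≤ B T`
    obtain ⟨C, hC, s, hs, H'⟩ := H (max σ 0 * (B * T) / (c₁ * Real.log 2)) (by positivity)
    refine ⟨C, hC, s, hs, fun ε hε hε2 => ?_⟩
    obtain ⟨K, hK, H''⟩ := H' ε hε hε2
    refine ⟨K, hK, fun E _ _ _ A hA h hh hhh₀ l hl n hmem hcn hnT => ?_⟩
    refine H'' E A hA h hh hhh₀ l hl n hmem hcn ?_
    have hℓ2 : Real.log 2 ≤ Real.log (1 / ε) := by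
      refine Real.log_le_log two_pos ?_
      rw [le_div_iff₀ hε]
      linarith
    have hℓ0 : 0 < Real.log (1 / ε) := hlog2.trans_le hℓ2
    have hBT : (B : ℝ) ^ l * h ≤ B * T := by
      calc (B : ℝ) ^ l * h = B * ((B : ℝ) ^ (l - 1) * h) := by
            rw [← mul_assoc, ← pow_succ', Nat.sub_add_cancel hl]
        _ ≤ B * (n * h) := mul_le_mul_of_nonneg_left hmem.1 hB0.le
        _ ≤ B * T := by gcongr
    have hμ : c₁ * Real.log 2 / (B * T) ≤ c₁ * Real.log (1 / ε) / ((B : ℝ) ^ l * h) := by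
      gcongr
    calc σ ≤ max σ 0 := le_max_left _ _
      _ = max σ 0 * (B * T) / (c₁ * Real.log 2) * (c₁ * Real.log 2 / (B * T)) := by field_simp
      _ ≤ _ := by gcongr
  · obtain ⟨C, hC, s, hs, H'⟩ := H 0 le_rfl
    refine ⟨C, hC, s, hs, fun ε hε hε2 => ?_⟩
    obtain ⟨K, hK, H''⟩ := H' ε hε hε2
    exact ⟨K, hK, fun E _ _ _ A hA h hh hhh₀ l hl n hmem hcn =>
      H'' E A hA h hh hhh₀ l hl n hmem hcn (by simpa using hσ)⟩
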